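/- Let $n,k\ge 1$ be integers, with $k\ge 2$ if $n=1$, and let $\Lambda$ be a lattice in $\mathbb R^n$ with covolume $\det(\Lambda)$. For $\boldsymbol l\in\Lambda\setminus\{0\}$ let $c_k(\boldsymbol l)$ be the largest integer $c$ with $\boldsymbol l\in c^k\Lambda$, put $c_k(0)=\infty$, and let $V=\{\boldsymbol l\in\Lambda : c_k(\boldsymbol l)=1\}$ be the set of $k$-free points of $\Lambda$. Let $\Lambda^*=\{\boldsymbol y\in\mathbb R^n : \boldsymbol y\cdot \boldsymbol x\in\mathbb Z\text{ for all }\boldsymbol x\in\Lambda\}$ be the dual lattice; the denominator of $\boldsymbol y\in\mathbb Q\Lambda^*$ is the smallest positive integer $a$ with $a\boldsymbol y\in\Lambda^*$. For a set $S$ write $\omega_S=\sum_{\boldsymbol x\in S}\delta_{\boldsymbol x}$. Let $\zeta$ be the Riemann zeta function and $\xi(s)=\sum_{m\ge1}\mu(m)\tau(m)m^{-s}$, where $\mu$ is the Möbius function and $\tau(m)$ the number of divisors of $m$. Products over $p$ are over primes. The natural autocorrelation $\gamma$ of $V$ is the vague limit, as $R\to\infty$, of $\frac{1}{\operatorname{vol}(B_R(0))}\sum_{\boldsymbol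 x,\boldsymbol y\in V\cap B_R(0)}\delta_{\boldsymbol x-\boldsymbol y}$, and the diffraction measure $\widehat\gamma$ of $V$ is the measure of temperate growth which is the Fourier transform of $\gamma$ as a tempered distribution (with kernel $e^{-2\pi i\,\boldsymbol x\cdot\boldsymbol y}$). Theorem. The diffraction measure $\widehat\gamma$ of $V$ exists and is unique. It is a positive, pure-point, translation-bounded measure (i.e. $\sup_{\boldsymbol x}\widehat\gamma(\boldsymbol x+K)<\infty$ for every compact $K$). It is concentrated on the set of points of $\mathbb Q\Lambda^*$ whose denominator is $(k+1)$-free (divisible by no $(k+1)$-th power of a prime), and at each such point, with denominator $q$, $$\widehat\gamma(\{\boldsymbol y\})=\frac{1}{\det(\Lambda)^2}\,\frac{1}{\zeta(nk)^2}\prod_{p\mid q}\frac{1}{(p^{nk}-1)^2}.$$ Moreover $$\widehat\gamma=\frac{\xi(nk)}{\det(\Lambda)^2}\sum_{d\ \mathrm{squarefree}}\Bigl(\prod_{p\mid d}\frac{1}{p^{2nk}-2p^{nk}}\Bigr)\,\omega_{\Lambda^*/d^k},$$ where $d$ runs over the squarefree positive integers and the series converges unconditionally, both in the weak* topology of tempered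 distributions and in the local norm, i.e. for every compact $K\subset\mathbb R^n$ the supremum over $\boldsymbol x\in\mathbb R^n$ of the total variation on $\boldsymbol x+K$ of the difference between $\widehat\gamma$ and the partial sum tends to $0$. -/

import Mathlib

open MeasureTheory Filter Topology
open scoped ENNReal FourierTransform SchwartzMap CompactlySupported Pointwise

noncomputable section

namespace KFreeDiffraction

/-! ### Lattices and `k`-free points -/

/-- The `k`-content of a point `l` of `Λ`: the largest `c` with `l ∈ c ^ k Λ` (it is `⊤` for
`l = 0`). -/
def kContent {n : ℕ} (Λ : Submodule ℤ (EuclideanSpace ℝ (Fin n))) (k : ℕ)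
    (l : EuclideanSpace ℝ (Fin n)) : ℕ∞ :=
  ⨆ c ∈ {c : ℕ | ∃ x ∈ Λ, c ^ k • x = l}, (c : ℕ∞)

/-- The `k`-free points of the lattice `Λ`. -/
def kFreePoints {n : ℕ} (Λ : Submodule ℤ (EuclideanSpace ℝ (Fin n))) (k : ℕ) :
    Set (EuclideanSpace ℝ (Fin n)) :=
  {l | l ∈ Λ ∧ kContent Λ k l = 1}

/-- The dual lattice `Λ*`. -/
def dualLattice {n : ℕ} (Λ : Submodule ℤ (EuclideanSpace ℝ (Fin n))) :
    Set (EuclideanSpace ℝ (Fin n)) :=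
  {y | ∀ x ∈ Λ, ∃ m : ℤ, inner ℝ y x = (m : ℝ)}

/-- The set `ℚΛ*` of rational multiples of points of the dual lattice. -/
def rationalDual {n : ℕ} (Λ : Submodule ℤ (EuclideanSpace ℝ (Fin n))) :
    Set (EuclideanSpace ℝ (Fin n)) :=
  {y | ∃ r : ℚ, ∃ z ∈ dualLattice Λ, y = (r : ℝ) • z}

/-- The denominator of a point `y` of `ℚΛ*`: the least positive integer `a` with `a y ∈ Λ*`. -/
def denominator {n : ℕ} (Λ : Submodule ℤ (EuclideanSpace ℝ (Fin n)))
    (y : EuclideanSpace ℝ (Fin n)) : ℕ :=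
  sInf {a : ℕ | 0 < a ∧ a • y ∈ dualLattice Λ}

/-- A natural number is `m`-free if no `m`-th power of a prime divides it. -/
def IsPowerFree (m q : ℕ) : Prop :=
  ∀ p : ℕ, p.Prime → ¬ p ^ m ∣ q

/-- The points of `ℚΛ*` with `(k + 1)`-free denominator. -/
def braggPositions {n : ℕ} (Λ : Submodule ℤ (EuclideanSpace ℝ (Fin n))) (k : ℕ) :
    Set (EuclideanSpace ℝ (Fin n)) :=
  {y | y ∈ rationalDual Λ ∧ IsPowerFree (k + 1) (denominator Λ y)}

/-! ### Measures: Dirac combs, autocorrelation, diffraction -/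

/-- The Dirac comb `ω_S = ∑_{x ∈ S} δ_x`. -/
def diracComb {n : ℕ} (S : Set (EuclideanSpace ℝ (Fin n))) :
    Measure (EuclideanSpace ℝ (Fin n)) :=
  Measure.sum fun x : S => Measure.dirac (x : EuclideanSpace ℝ (Fin n))

/-- The finite autocorrelation `vol(B_R)⁻¹ ω_{X_R} ∗ ω_{-X_R}`, where `X_R = X ∩ B_R(0)`,
that is, the sum of `δ_{x - y}` over all `x, y ∈ X_R`, divided by `vol(B_R)`. -/
def finiteAutocorrelation {n : ℕ} (X : Set (EuclideanSpace ℝ (Fin n))) (R : ℝ) :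
    Measure (EuclideanSpace ℝ (Fin n)) :=
  (volume (Metric.ball (0 : EuclideanSpace ℝ (Fin n)) R))⁻¹ •
    Measure.sum fun p : ↥(X ∩ Metric.ball 0 R) × ↥(X ∩ Metric.ball 0 R) =>
      Measure.dirac ((p.1 : EuclideanSpace ℝ (Fin n)) - (p.2 : EuclideanSpace ℝ (Fin n)))

/-- `γ` is the natural autocorrelation of `X`: a locally finite measure which is the vague limit
of the finite autocorrelations along balls centred at the origin. -/
def IsNaturalAutocorrelation {n : ℕ} (X : Set (EuclideanSpace ℝ (Fin n)))
    (γ : Measure (EuclideanSpace ℝ (Fin n))) : Prop :=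
  IsLocallyFiniteMeasure γ ∧
    ∀ f : C_c(EuclideanSpace ℝ (Fin n), ℝ),
      Tendsto (fun R : ℝ => ∫ x, f x ∂(finiteAutocorrelation X R)) atTop (𝓝 (∫ x, f x ∂γ))

/-- The tempered measure `μ` is the Fourier transform of the tempered measure `γ`, in the sense
of tempered distributions, with the normalization `exp (-2 π i x ⬝ y)`. -/
def IsFourierTransformOf {n : ℕ} (μ γ : Measure (EuclideanSpace ℝ (Fin n))) : Prop :=
  ∃ _ : γ.HasTemperateGrowth, ∃ _ : μ.HasTemperateGrowth,
    𝓕 γ.toTemperedDistribution = μ.toTemperedDistribution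

/-- `μ` is the diffraction measure of `X`: the Fourier transform of the natural
autocorrelation of `X`. -/
def IsDiffractionMeasure {n : ℕ} (X : Set (EuclideanSpace ℝ (Fin n)))
    (μ : Measure (EuclideanSpace ℝ (Fin n))) : Prop :=
  ∃ γ, IsNaturalAutocorrelation X γ ∧ IsFourierTransformOf μ γ

/-- Translation boundedness: the mass of the translates of any compact set is bounded. -/
def IsTranslationBounded {n : ℕ} (μ : Measure (EuclideanSpace ℝ (Fin n))) : Prop :=
  ∀ K : Set (EuclideanSpace ℝ (Fin n)), IsCompact K → ⨆ x : EuclideanSpace ℝ (Fin n), μ (x +ᵥ K) < ∞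

/-- A pure-point measure is concentrated on a countable set. -/
def IsPurePoint {n : ℕ} (μ : Measure (EuclideanSpace ℝ (Fin n))) : Prop :=
  ∃ S : Set (EuclideanSpace ℝ (Fin n)), S.Countable ∧ μ Sᶜ = 0

/-- The series `∑ ν i` of tempered measures converges to `μ` in the weak* topology of tempered
distributions (`HasSum` refers to the topology of pointwise convergence on Schwartz
functions). -/
def IsWeakStarSum {n : ℕ} {ι : Type*} (ν : ι → Measure (EuclideanSpace ℝ (Fin n)))
    (μ : Measure (EuclideanSpace ℝ (Fin n))) : Prop :=
  ∃ _ : ∀ i, (ν i).HasTemperateGrowth, ∃ _ : μ.HasTemperateGrowth,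
    HasSum (fun i => (ν i).toTemperedDistribution) μ.toTemperedDistribution

/-- The total variation `|μ - ν|` of the difference of two locally finite measures. Here `μ - ν`
on the right-hand side is the positive part of the signed difference. -/
def variationDiff {n : ℕ} (μ ν : Measure (EuclideanSpace ℝ (Fin n))) :
    Measure (EuclideanSpace ℝ (Fin n)) :=
  (μ - ν) + (ν - μ)

/-- The series `∑ ν i` converges to `μ` in the local norm `‖·‖_loc`, i.e. uniformly, in total
variation, on the translates of any compact set. -/
def IsLocalNormSum {n : ℕ} {ι : Type*} (ν : ι → Measure (EuclideanSpace ℝ (Fin n)))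
    (μ : Measure (EuclideanSpace ℝ (Fin n))) : Prop :=
  ∀ K : Set (EuclideanSpace ℝ (Fin n)), IsCompact K →
    Tendsto (fun s : Finset ι =>
      ⨆ x : EuclideanSpace ℝ (Fin n), variationDiff μ (∑ i ∈ s, ν i) (x +ᵥ K)) atTop (𝓝 0)

/-! ### The coefficients -/

/-- The Dirichlet series `ξ(s) = ∑_{m ≥ 1} μ(m) τ(m) / m ^ s`, where `μ` is the Möbius function
and `τ` the number of divisors. -/
def xi (s : ℕ) : ℝ :=
  ∑' m : ℕ, (ArithmeticFunction.moebius m : ℝ) * (m.divisors.card : ℝ) / (m : ℝ) ^ s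

/-- The term
`det(Λ)⁻² ξ(nk) (∏_{p ∣ d} 1 / (p ^ (2nk) - 2 p ^ (nk))) ω_{Λ* / d ^ k}` of the series. -/
def diffractionTerm {n : ℕ} (Λ : Submodule ℤ (EuclideanSpace ℝ (Fin n))) (k d : ℕ) :
    Measure (EuclideanSpace ℝ (Fin n)) :=
  ENNReal.ofReal
      (xi (n * k) * (∏ p ∈ d.primeFactors, 1 / ((p : ℝ) ^ (2 * n * k) - 2 * (p : ℝ) ^ (n * k)))
        / ZLattice.covolume Λ ^ 2) •
    diracComb {y | d ^ k • y ∈ dualLattice Λ}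

end KFreeDiffraction

end

/-! Write `s = n * k`; the hypotheses give `s ≥ 2`, so `p ^ s ≥ 4` and `∑ p ^ (-s)` converges.

A lattice point is `k`-free iff it avoids `p ^ k Λ` for every prime `p`. For `z ∈ Λ`, the points `x`
with `x` and `x - z` both `k`-free avoid the classes of `0` and `z` modulo each `p ^ k Λ`: one class
if `z ∈ p ^ k Λ`, two otherwise. By the Chinese remainder theorem, sieving by finitely many primes
leaves a set whose density is a product of local factors `1 - 1 / p ^ s` or `1 - 2 / p ^ s`, divided
by the covolume. The nonzero points of `p ^ k Λ` in a ball of radius `R` number at most a constant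
times `R ^ n / p ^ s`, so the remaining primes cost an error uniformly small in `R`, and the density
of the pairs is the full product (`hasDensity_kFreePairs`). All the measures live on `Λ`, so
convergence of these coefficients is vague convergence.

Since `1 - 1 / P = (1 - 2 / P) (1 + 1 / (P - 2))` with `P = p ^ s`, extracting `ξ(s) = ∏ (1 - 2 /
P)` and expanding the rest over finite sets of primes, i.e. over squarefree `d`, exhibits the
autocorrelation as `ξ(s) / det Λ` times `∑_d ∏_{p ∣ d} 1 / (P - 2)` times the comb of `d ^ k Λ`.
Poisson summation (`poisson_summation_multiples`) transforms each comb into that of `Λ* / d ^ k`,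
with a factor `1 / (det Λ * d ^ s)`, which yields the series claimed. The dual combs have local mass
of order `d ^ s`, cancelling exactly this factor: both series are dominated by the summable weights
`∏_{p ∣ d} 1 / (P - 2)`, uniformly in translations (`IsUniformlySummable`). Termwise Fourier
transformation, translation boundedness and both modes of convergence follow.

A point with `(k + 1)`-free denominator `q` lies in `Λ* / d ^ k` iff all primes of `q` divide `d`.
Summing those coefficients is again an Euler product (`xi_mul_tsum_coeff`), now with factors `(1 - 1
/ P) ^ 2`, modified at the primes of `q`. Uniqueness holds because test functions determine locally
finite measures. -/

namespace KFreeDiffraction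

/-! ### Sums over squarefree numbers and Euler products -/

/-- The prime numbers, as a subtype. -/
abbrev PrimeNat : Type := {p : ℕ // p.Prime}

/-- A squarefree number is the same as a finite set of primes. -/
noncomputable def squarefreeEquiv : {d : ℕ // Squarefree d} ≃ Finset PrimeNat where
  toFun d := (d : ℕ).primeFactors.subtype Nat.Prime
  invFun s := ⟨∏ p ∈ s, (p : ℕ), by
    refine Finset.squarefree_prod_of_pairwise_isCoprime (fun p _ q _ hpq => ?_)
      fun p _ => p.2.squarefree
    exact Nat.coprime_iff_isRelPrime.1 ((Nat.coprime_primes p.2 q.2).2 fun h => hpq (Subtype.ext h))⟩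
  left_inv d := by
    apply Subtype.ext
    change ∏ p ∈ (d : ℕ).primeFactors.subtype Nat.Prime, (p : ℕ) = d
    rw [Finset.prod_subtype_of_mem (fun p => p) fun p hp => Nat.prime_of_mem_primeFactors hp]
    exact Nat.prod_primeFactors_of_squarefree d.2
  right_inv s := by
    ext p
    have h : (∏ q ∈ s, (q : ℕ)).primeFactors = s.image (fun q : PrimeNat => (q : ℕ)) := by
      rw [← Finset.prod_image (s := s) (g := fun q : PrimeNat => (q : ℕ)) (f := fun q => q)
        (fun a _ b _ h => Subtype.ext h)]
      exact Nat.primeFactors_prod fun q hq => by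
        obtain ⟨r, _, rfl⟩ := Finset.mem_image.1 hq
        exact r.2
    simp only [Finset.mem_subtype, h, Finset.mem_image]
    exact ⟨fun ⟨a, ha, hap⟩ => (Subtype.ext hap : a = p) ▸ ha, fun hp => ⟨p, hp, rfl⟩⟩

theorem mem_squarefreeEquiv {d : {d : ℕ // Squarefree d}} {p : PrimeNat} :
    p ∈ squarefreeEquiv d ↔ (p : ℕ) ∣ d := by
  change p ∈ (d : ℕ).primeFactors.subtype Nat.Prime ↔ _
  simp [Finset.mem_subtype, p.2, d.2.ne_zero]

theorem prod_squarefreeEquiv {M : Type*} [CommMonoid M] (g : ℕ → M)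
    (d : {d : ℕ // Squarefree d}) :
    ∏ p ∈ squarefreeEquiv d, g p = ∏ p ∈ (d : ℕ).primeFactors, g p :=
  Finset.prod_subtype_of_mem g fun _ hp => Nat.prime_of_mem_primeFactors hp

theorem summable_squarefree_prod {g : ℕ → ℝ} (hg : Summable fun p : PrimeNat => |g p|) :
    Summable fun d : {d : ℕ // Squarefree d} => ∏ p ∈ (d : ℕ).primeFactors, g p := by
  have h := summable_finsetProd_of_summable_norm (f := fun p : PrimeNat => g p) hg
  refine (squarefreeEquiv.summable_iff.2 h).congr fun d => ?_
  exact prod_squarefreeEquiv g d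

/-- An Euler product with the factor at each prime of `Q` modified. -/
theorem hasProd_ite_add {g : ℕ → ℝ} (hg : Summable fun p : PrimeNat => |g p|)
    (Q : Finset ℕ) (hQ : ∀ p ∈ Q, p.Prime) :
    HasProd (fun p : PrimeNat => g p + if (p : ℕ) ∈ Q then 0 else 1)
      (∑' d : {d : ℕ // Squarefree d},
        if Q ⊆ (d : ℕ).primeFactors then ∏ p ∈ (d : ℕ).primeFactors, g p else 0) := by
  classical
  set Q' : Finset PrimeNat := Q.subtype Nat.Prime with hQ'
  set f : Finset PrimeNat → ℝ := fun s => if Q' ⊆ s then ∏ p ∈ s, g p else 0 with hf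
  have hsum : Summable f := by
    refine (summable_finsetProd_of_summable_norm (f := fun p : PrimeNat => g p) hg).norm.of_norm_bounded
      fun s => ?_
    by_cases h : Q' ⊆ s
    · simp [hf, h]
    · simp only [hf, h, if_false, norm_zero]
      positivity
  have hmem : ∀ p : PrimeNat, p ∈ Q' ↔ (p : ℕ) ∈ Q := fun p => by
    rw [hQ', Finset.mem_subtype]
  have htsum : (∑' d : {d : ℕ // Squarefree d},
        if Q ⊆ (d : ℕ).primeFactors then ∏ p ∈ (d : ℕ).primeFactors, g p else 0) = ∑' s, f s := by
    rw [← squarefreeEquiv.tsum_eq f]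
    refine tsum_congr fun d => ?_
    have : Q' ⊆ squarefreeEquiv d ↔ Q ⊆ (d : ℕ).primeFactors := by
      constructor
      · intro h p hp
        have := h ((hmem ⟨p, hQ p hp⟩).2 hp)
        rw [mem_squarefreeEquiv] at this
        exact Nat.mem_primeFactors.2 ⟨hQ p hp, this, d.2.ne_zero⟩
      · intro h p hp
        rw [mem_squarefreeEquiv]
        exact Nat.dvd_of_mem_primeFactors (h ((hmem p).1 hp))
    simp only [hf, this, prod_squarefreeEquiv]
  rw [htsum]
  -- Expanding the product over `S` gives a sum over the subsets `t` of `S`; the factors over `S \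
  -- t` annihilate each `t` not containing `Q'`, once `Q' ⊆ S`.
  have h := hsum.hasSum.comp tendsto_finset_powerset_atTop_atTop
  refine Tendsto.congr' ?_ h
  filter_upwards [eventually_ge_atTop Q'] with S hS
  rw [Finset.prod_add]
  simp only [Function.comp, hf]
  refine Finset.sum_congr rfl fun t ht => ?_
  have key : ∏ i ∈ S \ t, (if (i : ℕ) ∈ Q then (0 : ℝ) else 1) = if Q' ⊆ t then 1 else 0 := by
    by_cases h : Q' ⊆ t
    · rw [if_pos h]
      refine Finset.prod_eq_one fun i hi => if_neg fun hiQ => ?_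
      exact (Finset.mem_sdiff.1 hi).2 (h ((hmem i).2 hiQ))
    · rw [if_neg h]
      obtain ⟨i, hi, hit⟩ := Finset.not_subset.1 h
      exact Finset.prod_eq_zero (Finset.mem_sdiff.2 ⟨hS hi, hit⟩) (if_pos ((hmem i).1 hi))
  rw [key]
  split_ifs <;> simp

theorem hasProd_one_add {g : ℕ → ℝ} (hg : Summable fun p : PrimeNat => |g p|) :
    HasProd (fun p : PrimeNat => 1 + g p)
      (∑' d : {d : ℕ // Squarefree d}, ∏ p ∈ (d : ℕ).primeFactors, g p) := by
  simpa [add_comm] using hasProd_ite_add hg ∅ (by simp)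

theorem four_le_prime_pow (p : PrimeNat) {s : ℕ} (hs : 2 ≤ s) : (4 : ℝ) ≤ (p : ℝ) ^ s := by
  have hp : (2 : ℝ) ≤ (p : ℕ) := by exact_mod_cast p.2.two_le
  calc (4 : ℝ) = 2 ^ 2 := by norm_num
    _ ≤ 2 ^ s := pow_le_pow_right₀ (by norm_num) hs
    _ ≤ _ := pow_le_pow_left₀ (by norm_num) hp s

theorem summable_one_div_prime_pow {s : ℕ} (hs : 2 ≤ s) :
    Summable fun p : PrimeNat => 1 / (p : ℝ) ^ s :=
  (Real.summable_one_div_nat_pow.2 (by omega)).comp_injective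
    (i := fun p : PrimeNat => (p : ℕ)) Subtype.val_injective

theorem summable_abs_of_le {s : ℕ} (hs : 2 ≤ s) {g : ℕ → ℝ} {C : ℝ}
    (h : ∀ p : PrimeNat, |g p| ≤ C * (1 / (p : ℝ) ^ s)) :
    Summable fun p : PrimeNat => |g p| :=
  ((summable_one_div_prime_pow hs).mul_left C).of_nonneg_of_le (fun _ => abs_nonneg _) h

/-- The term of the Dirichlet series `ξ` at a squarefree number. -/
theorem xi_summand_of_squarefree (s : ℕ) {d : ℕ} (hd : Squarefree d) :
    (ArithmeticFunction.moebius d : ℝ) * (d.divisors.card : ℝ) / (d : ℝ) ^ s =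
      ∏ p ∈ d.primeFactors, -(2 / (p : ℝ) ^ s) := by
  have h1 : (ArithmeticFunction.moebius d : ℝ) = ∏ p ∈ d.primeFactors, (-1 : ℝ) := by
    rw [ArithmeticFunction.moebius_apply_of_squarefree hd, Finset.prod_const,
      ← (ArithmeticFunction.cardDistinctFactors_eq_cardFactors_iff_squarefree hd.ne_zero).2 hd,
      ArithmeticFunction.cardDistinctFactors_apply, Nat.primeFactors, List.card_toFinset]
    push_cast
    rfl
  have h2 : (d.divisors.card : ℝ) = ∏ p ∈ d.primeFactors, (2 : ℝ) := by
    rw [Nat.card_divisors hd.ne_zero, Nat.cast_prod]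
    refine Finset.prod_congr rfl fun p hp => ?_
    rw [Nat.factorization_eq_one_of_squarefree hd (Nat.prime_of_mem_primeFactors hp)
      (Nat.dvd_of_mem_primeFactors hp)]
    norm_num
  have h3 : (d : ℝ) ^ s = ∏ p ∈ d.primeFactors, (p : ℝ) ^ s := by
    conv_lhs => rw [← Nat.prod_primeFactors_of_squarefree hd]
    rw [Nat.cast_prod, Finset.prod_pow]
  rw [h1, h2, h3, ← Finset.prod_mul_distrib, ← Finset.prod_div_distrib]
  exact Finset.prod_congr rfl fun p _ => by ring

theorem xi_eq_tsum_squarefree (s : ℕ) :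
    xi s = ∑' d : {d : ℕ // Squarefree d}, ∏ p ∈ (d : ℕ).primeFactors, -(2 / (p : ℝ) ^ s) := by
  have hsupp : Function.support (fun m : ℕ => (ArithmeticFunction.moebius m : ℝ) *
      (m.divisors.card : ℝ) / (m : ℝ) ^ s) ⊆ {d : ℕ | Squarefree d} := by
    intro m hm
    by_contra hsq
    refine hm ?_
    simp only [ArithmeticFunction.moebius_eq_zero_of_not_squarefree hsq,
      Int.cast_zero, zero_mul, zero_div]
  rw [xi, ← tsum_subtype_eq_of_support_subset hsupp]
  exact tsum_congr fun d => xi_summand_of_squarefree s d.2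

theorem summable_two_div_prime_pow {s : ℕ} (hs : 2 ≤ s) :
    Summable fun p : PrimeNat => |(fun p : ℕ => -(2 / (p : ℝ) ^ s)) p| := by
  refine summable_abs_of_le (g := fun p : ℕ => -(2 / (p : ℝ) ^ s)) hs (C := 2) fun p => ?_
  have : (0 : ℝ) < (p : ℝ) ^ s := by linarith [four_le_prime_pow p hs]
  rw [abs_neg, abs_of_pos (by positivity)]
  exact le_of_eq (by ring)

/-- The Dirichlet series `ξ` has an Euler product. -/
theorem hasProd_xi {s : ℕ} (hs : 2 ≤ s) :
    HasProd (fun p : PrimeNat => 1 - 2 / (p : ℝ) ^ s) (xi s) := by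
  rw [xi_eq_tsum_squarefree]
  simpa only [sub_eq_add_neg] using
    hasProd_one_add (g := fun p : ℕ => -(2 / (p : ℝ) ^ s)) (summable_two_div_prime_pow hs)

/-- Every Euler factor is positive because `p ^ s ≥ 4 > 2`. This only makes the limit nonnegative;
it is nonzero because `∑ 2 / p ^ s` converges. -/
theorem xi_pos {s : ℕ} (hs : 2 ≤ s) : 0 < xi s := by
  have h := hasProd_xi hs
  have hpos : ∀ p : PrimeNat, 0 < 1 - 2 / (p : ℝ) ^ s := fun p => by
    have := four_le_prime_pow p hs
    rw [sub_pos, div_lt_one (by linarith)]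
    linarith
  have hnn : 0 ≤ xi s := ge_of_tendsto' h fun S => Finset.prod_nonneg fun p _ => (hpos p).le
  refine lt_of_le_of_ne hnn (Ne.symm ?_)
  rw [← h.tprod_eq]
  simp only [sub_eq_add_neg]
  refine tprod_one_add_ne_zero_of_summable (fun p => ?_) ?_
  · have := hpos p
    rw [sub_eq_add_neg] at this
    exact this.ne'
  · exact summable_two_div_prime_pow hs

theorem hasProd_one_div_riemannZeta {s : ℕ} (hs : 2 ≤ s) :
    HasProd (fun p : PrimeNat => 1 - 1 / ((p : ℕ) : ℂ) ^ s) (1 / riemannZeta (s : ℂ)) := by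
  have hs1 : 1 < ((s : ℕ) : ℂ).re := by simpa using (show 1 < s by omega)
  have h : HasProd (fun p : PrimeNat => (1 - ((p : ℕ) : ℂ) ^ (-(s : ℂ)))⁻¹) (riemannZeta s) :=
    riemannZeta_eulerProduct_hasProd hs1
  have h' := Tendsto.inv₀ h (riemannZeta_ne_zero_of_one_le_re hs1.le)
  rw [one_div]
  refine Tendsto.congr (fun S => ?_) h'
  rw [← Finset.prod_inv_distrib]
  refine Finset.prod_congr rfl fun p _ => ?_
  simp only [inv_inv, Complex.cpow_neg, Complex.cpow_natCast, one_div]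

theorem two_mul_pow_lt {s : ℕ} (hs : 2 ≤ s) (p : PrimeNat) :
    0 < (p : ℝ) ^ (2 * s) - 2 * (p : ℝ) ^ s := by
  have := four_le_prime_pow p hs
  rw [two_mul s, pow_add]
  nlinarith

theorem summable_series_coeff {s : ℕ} (hs : 2 ≤ s) :
    Summable fun p : PrimeNat =>
      |(fun p : ℕ => 1 / ((p : ℝ) ^ (2 * s) - 2 * (p : ℝ) ^ s)) p| := by
  refine summable_abs_of_le
    (g := fun p : ℕ => 1 / ((p : ℝ) ^ (2 * s) - 2 * (p : ℝ) ^ s)) hs (C := 1) fun p => ?_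
  have h4 := four_le_prime_pow p hs
  have := two_mul_pow_lt hs p
  rw [abs_of_pos (by positivity), one_mul]
  refine one_div_le_one_div_of_le (by linarith) ?_
  rw [two_mul s, pow_add]
  nlinarith

/-- The sum of the coefficients of those terms of the series that charge a point whose
denominator has the set `Q` of prime factors. -/
theorem xi_mul_tsum_coeff {s : ℕ} (hs : 2 ≤ s) (Q : Finset ℕ) (hQ : ∀ p ∈ Q, p.Prime) :
    ((xi s * ∑' d : {d : ℕ // Squarefree d}, if Q ⊆ (d : ℕ).primeFactors then
        ∏ p ∈ (d : ℕ).primeFactors, 1 / ((p : ℝ) ^ (2 * s) - 2 * (p : ℝ) ^ s) else 0 : ℝ) : ℂ) =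
      1 / riemannZeta (s : ℂ) ^ 2 * ∏ p ∈ Q, 1 / ((p : ℂ) ^ s - 1) ^ 2 := by
  classical
  have h1 := ((hasProd_xi hs).mul (hasProd_ite_add
    (g := fun p : ℕ => 1 / ((p : ℝ) ^ (2 * s) - 2 * (p : ℝ) ^ s)) (summable_series_coeff hs) Q hQ)).map
    Complex.ofRealHom Complex.continuous_ofReal
  have hζ := hasProd_one_div_riemannZeta hs
  have hQp : HasProd (fun p : PrimeNat => if (p : ℕ) ∈ Q then 1 / (((p : ℕ) : ℂ) ^ s - 1) ^ 2 else 1)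
      (∏ p ∈ Q, 1 / ((p : ℂ) ^ s - 1) ^ 2) := by
    have := hasProd_prod_of_ne_finset_one (s := Q.subtype Nat.Prime)
      (f := fun p : PrimeNat => if (p : ℕ) ∈ Q then 1 / (((p : ℕ) : ℂ) ^ s - 1) ^ 2 else 1)
      (L := SummationFilter.unconditional _)
      (fun p hp => if_neg fun h => hp (Finset.mem_subtype.2 h))
    convert this using 1
    rw [Finset.prod_subtype_of_mem (fun p : ℕ => if p ∈ Q then 1 / ((p : ℂ) ^ s - 1) ^ 2 else 1) hQ]
    exact Finset.prod_congr rfl fun p hp => (if_pos hp).symm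
  have h2 := (hζ.mul hζ).mul hQp
  rw [show 1 / riemannZeta (s : ℂ) ^ 2 = 1 / riemannZeta (s : ℂ) * (1 / riemannZeta (s : ℂ)) by
    rw [div_mul_div_comm, one_mul, sq]]
  refine h1.unique ?_
  convert h2 using 1
  funext p
  have h4 := four_le_prime_pow p hs
  have h0 : ((p : ℕ) : ℝ) ^ s ≠ 0 := by linarith
  have h20 : ((p : ℕ) : ℝ) ^ s - 2 ≠ 0 := by linarith
  have h10 : ((p : ℕ) : ℝ) ^ s - 1 ≠ 0 := by linarith
  -- With `P = p ^ s`, the left side is `1 / P ^ 2` at primes of `Q`; elsewhere `P (P - 2) + 1 = (P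
  -- - 1) ^ 2` makes it `(1 - 1 / P) ^ 2`.
  have key : (1 - 2 / (p : ℝ) ^ s) * (1 / ((p : ℝ) ^ (2 * s) - 2 * (p : ℝ) ^ s) +
      if (p : ℕ) ∈ Q then 0 else 1) = (1 - 1 / (p : ℝ) ^ s) * (1 - 1 / (p : ℝ) ^ s) *
      if (p : ℕ) ∈ Q then 1 / ((p : ℝ) ^ s - 1) ^ 2 else 1 := by
    have hsub : (p : ℝ) ^ (2 * s) - 2 * (p : ℝ) ^ s = (p : ℝ) ^ s * ((p : ℝ) ^ s - 2) := by ring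
    rw [hsub]
    split_ifs
    · field_simp
      ring
    · field_simp
      ring
  simp only [Function.comp, Complex.ofRealHom_eq_coe]
  rw [key]
  push_cast
  split_ifs <;> simp

/-! ### Dirac combs of uniformly discrete sets -/

section Measures

variable {n : ℕ}

theorem diracComb_apply (S : Set (EuclideanSpace ℝ (Fin n))) {A : Set (EuclideanSpace ℝ (Fin n))}
    (hA : MeasurableSet A) : diracComb S A = ∑' x : S, A.indicator 1 (x : EuclideanSpace ℝ (Fin n)) := by
  rw [diracComb, Measure.sum_apply _ hA]
  exact tsum_congr fun x => Measure.dirac_apply' _ hA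

/-- A packing bound for the number of points of a uniformly discrete set in a ball. -/
theorem diracComb_ball_le {S : Set (EuclideanSpace ℝ (Fin n))} {r : ℝ} (hr : 0 < r)
    (hS : ∀ x ∈ S, ∀ y ∈ S, x ≠ y → r ≤ dist x y) (y : EuclideanSpace ℝ (Fin n)) {R : ℝ}
    (hR : 0 ≤ R) :
    diracComb S (Metric.ball y R) ≤ ENNReal.ofReal ((2 * R / r + 1) ^ n) := by
  classical
  -- The balls of radius `r / 2` about the counted points are disjoint and fit into a ball of radius
  -- `R + r / 2`; the bound is the ratio of volumes.
  set A : S → Set (EuclideanSpace ℝ (Fin n)) := fun x =>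
    if (x : EuclideanSpace ℝ (Fin n)) ∈ Metric.ball y R then Metric.ball x (r / 2) else ∅ with hA
  have hmeas : ∀ x, MeasurableSet (A x) := fun x => by
    simp only [hA]
    split_ifs
    · exact measurableSet_ball
    · exact MeasurableSet.empty
  have hdisj : Pairwise (Function.onFun Disjoint A) := by
    intro x x' hne
    simp only [Function.onFun, hA]
    split_ifs
    · refine Metric.ball_disjoint_ball ?_
      rw [add_halves]
      exact hS x x.2 x' x'.2 fun h => hne (Subtype.ext h)
    all_goals simp
  have hsub : (⋃ x, A x) ⊆ Metric.ball y (R + r / 2) := by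
    refine Set.iUnion_subset fun x => ?_
    simp only [hA]
    split_ifs with h
    · refine Metric.ball_subset_ball' ?_
      rw [Metric.mem_ball] at h
      linarith
    · exact Set.empty_subset _
  have h1 := (tsum_meas_le_meas_iUnion_of_disjoint volume hmeas hdisj).trans (measure_mono hsub)
  have hV0 : volume (Metric.ball (0 : EuclideanSpace ℝ (Fin n)) 1) ≠ 0 :=
    (Metric.measure_ball_pos _ _ one_pos).ne'
  have hVt : volume (Metric.ball (0 : EuclideanSpace ℝ (Fin n)) 1) ≠ ∞ := measure_ball_lt_top.ne
  have h2 : ∀ x, volume (A x) = (Metric.ball y R).indicator 1 (x : EuclideanSpace ℝ (Fin n)) *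
      (ENNReal.ofReal ((r / 2) ^ n) * volume (Metric.ball (0 : EuclideanSpace ℝ (Fin n)) 1)) := by
    intro x
    by_cases h : (x : EuclideanSpace ℝ (Fin n)) ∈ Metric.ball y R
    · simp only [hA, if_pos h, Set.indicator_of_mem h]
      rw [Measure.addHaar_ball_of_pos _ _ (half_pos hr), finrank_euclideanSpace_fin]
      simp
    · simp only [hA, if_neg h, Set.indicator_of_notMem h]
      simp
  simp only [h2] at h1
  rw [ENNReal.tsum_mul_right, ← diracComb_apply S measurableSet_ball,
    Measure.addHaar_ball_of_pos volume y (by positivity), finrank_euclideanSpace_fin, ← mul_assoc,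
    ENNReal.mul_le_mul_iff_left hV0 hVt] at h1
  have hr2 : ENNReal.ofReal ((r / 2) ^ n) ≠ 0 := by
    rw [Ne, ENNReal.ofReal_eq_zero, not_le]
    positivity
  rw [← ENNReal.mul_le_mul_iff_left hr2 ENNReal.ofReal_ne_top]
  refine h1.trans (le_of_eq ?_)
  rw [← ENNReal.ofReal_mul (by positivity), ← mul_pow]
  congr 2
  field_simp

/-- The masses of all balls of a given radius are bounded. -/
def IsBallBounded (μ : Measure (EuclideanSpace ℝ (Fin n))) : Prop :=
  ∀ R : ℝ, ∃ C : ℝ≥0∞, C ≠ ∞ ∧ ∀ x, μ (Metric.ball x R) ≤ C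

theorem isBallBounded_diracComb {S : Set (EuclideanSpace ℝ (Fin n))} {r : ℝ} (hr : 0 < r)
    (hS : ∀ x ∈ S, ∀ y ∈ S, x ≠ y → r ≤ dist x y) : IsBallBounded (diracComb S) := fun R => by
  refine ⟨_, ENNReal.ofReal_ne_top (r := (2 * max R 0 / r + 1) ^ n), fun x => ?_⟩
  exact (measure_mono (Metric.ball_subset_ball (le_max_left R 0))).trans
    (diracComb_ball_le hr hS x (le_max_right R 0))

theorem IsBallBounded.isTranslationBounded {μ : Measure (EuclideanSpace ℝ (Fin n))}
    (hμ : IsBallBounded μ) : IsTranslationBounded μ := fun K hK => by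
  obtain ⟨R, hR⟩ := hK.isBounded.subset_ball (0 : EuclideanSpace ℝ (Fin n))
  obtain ⟨C, hC, h⟩ := hμ R
  refine lt_of_le_of_lt (iSup_le fun x => ?_) hC.lt_top
  refine (measure_mono ?_).trans (h x)
  rintro _ ⟨y, hy, rfl⟩
  simpa [Metric.mem_ball, dist_eq_norm] using hR hy

theorem IsBallBounded.isLocallyFiniteMeasure {μ : Measure (EuclideanSpace ℝ (Fin n))}
    (hμ : IsBallBounded μ) : IsLocallyFiniteMeasure μ := by
  obtain ⟨C, hC, h⟩ := hμ 1
  exact ⟨fun x => ⟨Metric.ball x 1, Metric.ball_mem_nhds x one_pos, (h x).trans_lt hC.lt_top⟩⟩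

/-- The weight `(1 + ‖x‖) ^ (-(n + 1))` is Lebesgue integrable and varies by a bounded factor over
unit balls. Averaging it over such balls and exchanging integrals bounds its `μ`-integral by its
Lebesgue integral. -/
theorem IsBallBounded.hasTemperateGrowth {μ : Measure (EuclideanSpace ℝ (Fin n))}
    (hμ : IsBallBounded μ) : μ.HasTemperateGrowth := by
  have := hμ.isLocallyFiniteMeasure
  obtain ⟨C, hC, hball⟩ := hμ 1
  have hint : Integrable (fun x : EuclideanSpace ℝ (Fin n) => (1 + ‖x‖) ^ (-((n + 1 : ℕ) : ℝ))) :=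
    integrable_one_add_norm (by rw [finrank_euclideanSpace_fin]; push_cast; linarith)
  set N : ℝ := ((n + 1 : ℕ) : ℝ) with hN
  have hN0 : 0 ≤ N := by positivity
  set h : EuclideanSpace ℝ (Fin n) → ℝ≥0∞ := fun x => ENNReal.ofReal ((1 + ‖x‖) ^ (-N)) with hh
  have hmeas : Measurable h := by fun_prop
  have hhfin : ∫⁻ x, h x ≠ ∞ := by
    have := hint.lintegral_lt_top
    exact this.ne
  set V := volume (Metric.ball (0 : EuclideanSpace ℝ (Fin n)) 1) with hV
  have hV0 : V ≠ 0 := (Metric.measure_ball_pos _ _ one_pos).ne'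
  have hVt : V ≠ ∞ := measure_ball_lt_top.ne
  -- Integrating this kernel in `y` dominates `h x * V`; integrating in `x` against `μ` costs at
  -- most `C`. The factor `2 ^ N` comes from `1 + ‖y‖ ≤ 2 * (1 + ‖x‖)` for `dist x y < 1`.
  set F : EuclideanSpace ℝ (Fin n) → EuclideanSpace ℝ (Fin n) → ℝ≥0∞ := fun x y =>
    {p : EuclideanSpace ℝ (Fin n) × EuclideanSpace ℝ (Fin n) | dist p.1 p.2 < 1}.indicator
      (fun p => ENNReal.ofReal (2 ^ N) * h p.2) (x, y) with hF
  have hFm : Measurable (Function.uncurry F) := by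
    refine Measurable.indicator ?_ (measurableSet_lt (by fun_prop) measurable_const)
    fun_prop
  have h1 : ∀ x, h x * V ≤ ∫⁻ y, F x y := by
    intro x
    have : ∀ y, (Metric.ball x 1).indicator (fun _ => h x) y ≤ F x y := by
      intro y
      by_cases hy : y ∈ Metric.ball x 1
      · have hxy : (x, y) ∈ {p : EuclideanSpace ℝ (Fin n) × EuclideanSpace ℝ (Fin n) |
            dist p.1 p.2 < 1} := by
          rw [Set.mem_ofPred_eq, dist_comm]
          exact hy
        simp only [hF]
        rw [Set.indicator_of_mem hy, Set.indicator_of_mem hxy]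
        simp only [hh]
        rw [← ENNReal.ofReal_mul (by positivity)]
        refine ENNReal.ofReal_le_ofReal ?_
        have hyx : ‖y‖ ≤ ‖x‖ + 1 := by
          have h3 : ‖y - x‖ < 1 := by rwa [Metric.mem_ball, dist_eq_norm] at hy
          have := norm_add_le x (y - x)
          rw [add_sub_cancel] at this
          linarith
        have h2 : (1 + ‖y‖) ≤ 2 * (1 + ‖x‖) := by linarith [norm_nonneg x]
        have h4 : (2 * (1 + ‖x‖)) ^ (-N) ≤ (1 + ‖y‖) ^ (-N) :=
          Real.rpow_le_rpow_of_nonpos (by positivity) h2 (by linarith)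
        rw [Real.mul_rpow (by norm_num) (by positivity)] at h4
        have h5 : (2 : ℝ) ^ N * 2 ^ (-N) = 1 := by
          rw [← Real.rpow_add (by norm_num)]
          simp
        calc (1 + ‖x‖) ^ (-N) = 2 ^ N * (2 ^ (-N) * (1 + ‖x‖) ^ (-N)) := by
              rw [← mul_assoc, h5, one_mul]
          _ ≤ _ := by gcongr
      · rw [Set.indicator_of_notMem hy]
        exact zero_le
    refine le_trans (le_of_eq ?_) (lintegral_mono this)
    rw [lintegral_indicator measurableSet_ball, setLIntegral_const,
      Measure.addHaar_ball_center]
  have h2 : ∀ y, ∫⁻ x, F x y ∂μ ≤ ENNReal.ofReal (2 ^ N) * h y * C := by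
    intro y
    have : ∀ x, F x y = (Metric.ball y 1).indicator (fun _ => ENNReal.ofReal (2 ^ N) * h y) x :=
      fun x => rfl
    simp only [this]
    rw [lintegral_indicator measurableSet_ball, setLIntegral_const]
    gcongr
    exact hball y
  have h3 : (∫⁻ x, h x ∂μ) * V ≤ ENNReal.ofReal (2 ^ N) * (∫⁻ x, h x) * C := by
    rw [← lintegral_mul_const _ hmeas]
    refine (lintegral_mono h1).trans ?_
    rw [lintegral_lintegral_swap hFm.aemeasurable]
    refine (lintegral_mono h2).trans (le_of_eq ?_)
    rw [lintegral_mul_const _ (by fun_prop), lintegral_const_mul _ hmeas]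
  have h4 : ∫⁻ x, h x ∂μ ≠ ∞ := by
    intro htop
    rw [htop, ENNReal.top_mul hV0, top_le_iff] at h3
    exact ENNReal.mul_ne_top (ENNReal.mul_ne_top ENNReal.ofReal_ne_top hhfin) hC h3
  refine ⟨n + 1, ⟨Measurable.aestronglyMeasurable (by fun_prop), ?_⟩⟩
  rw [hasFiniteIntegral_iff_ofReal (Eventually.of_forall fun x => by positivity)]
  exact h4.lt_top

/-- The masses of the measures `ν i` on balls of a given radius are uniformly summable. -/
def IsUniformlySummable {ι : Type*} (ν : ι → Measure (EuclideanSpace ℝ (Fin n))) : Prop :=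
  ∃ ε : ι → ℝ≥0∞, ∑' i, ε i ≠ ∞ ∧
    ∀ R : ℝ, ∃ C : ℝ≥0∞, C ≠ ∞ ∧ ∀ i x, ν i (Metric.ball x R) ≤ C * ε i

variable {ι : Type*} {ν : ι → Measure (EuclideanSpace ℝ (Fin n))}

theorem IsUniformlySummable.isBallBounded_sum (hν : IsUniformlySummable ν) :
    IsBallBounded (Measure.sum ν) := fun R => by
  obtain ⟨ε, hε, h⟩ := hν
  obtain ⟨C, hC, hb⟩ := h R
  refine ⟨C * ∑' i, ε i, ENNReal.mul_ne_top hC hε, fun x => ?_⟩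
  rw [Measure.sum_apply _ measurableSet_ball, ← ENNReal.tsum_mul_left]
  exact ENNReal.tsum_le_tsum fun i => hb i x

theorem IsUniformlySummable.isBallBounded (hν : IsUniformlySummable ν) (i : ι) :
    IsBallBounded (ν i) := fun R => by
  obtain ⟨C, hC, hb⟩ := hν.isBallBounded_sum R
  exact ⟨C, hC, fun x => (Measure.le_sum ν i _).trans (hb x)⟩

theorem IsUniformlySummable.isWeakStarSum (hν : IsUniformlySummable ν) :
    IsWeakStarSum ν (Measure.sum ν) := by
  have h1 := fun i => (hν.isBallBounded i).hasTemperateGrowth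
  have h2 := hν.isBallBounded_sum.hasTemperateGrowth
  refine ⟨h1, h2, ?_⟩
  rw [HasSum, PointwiseConvergenceCLM.tendsto_iff_forall_tendsto]
  intro f
  have h3 := hasSum_integral_measure (f.integrable (μ := Measure.sum ν))
  refine Tendsto.congr (fun s => ?_) h3
  rw [sum_apply]
  rfl

/-- Partial sums lie below the full sum, so one half of `variationDiff` vanishes and the other is at
most the tail. On any translate of `K` the tail has mass at most `C` times the tail of `∑ ε`. -/
theorem IsUniformlySummable.isLocalNormSum (hν : IsUniformlySummable ν) :
    IsLocalNormSum ν (Measure.sum ν) := fun K hK => by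
  obtain ⟨ε, hε, h⟩ := hν
  obtain ⟨R, hR⟩ := hK.isBounded.subset_ball (0 : EuclideanSpace ℝ (Fin n))
  obtain ⟨C, hC, hb⟩ := h R
  have hlim : Tendsto (fun s : Finset ι => C * ∑' b : {x // x ∉ s}, ε b) atTop (𝓝 0) := by
    have := ENNReal.Tendsto.const_mul (a := C) (ENNReal.tendsto_tsum_compl_atTop_zero hε) (Or.inr hC)
    rwa [mul_zero] at this
  refine tendsto_of_tendsto_of_tendsto_of_le_of_le tendsto_const_nhds hlim (fun _ => zero_le)
    fun s => iSup_le fun x => ?_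
  have hsplit : Measure.sum (fun i : {x // x ∉ s} => ν i) + ∑ i ∈ s, ν i = Measure.sum ν := by
    rw [← Measure.sum_add_sum_compl (s : Set ι) ν, add_comm, ← Measure.sum_coe_finset]
    rfl
  have hle : variationDiff (Measure.sum ν) (∑ i ∈ s, ν i) ≤
      Measure.sum fun i : {x // x ∉ s} => ν i := by
    rw [variationDiff, Measure.sub_eq_zero_of_le (μ := ∑ i ∈ s, ν i), add_zero]
    · exact Measure.sub_le_of_le_add hsplit.ge
    · rw [← hsplit]
      exact Measure.le_add_left le_rfl
  refine (hle _).trans ?_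
  have hsub : x +ᵥ K ⊆ Metric.ball x R := by
    rintro _ ⟨y, hy, rfl⟩
    simpa [Metric.mem_ball, dist_eq_norm] using hR hy
  refine (measure_mono hsub).trans ?_
  rw [Measure.sum_apply _ measurableSet_ball, ← ENNReal.tsum_mul_left]
  exact ENNReal.tsum_le_tsum fun i => hb i x

theorem integral_diracComb {S : Set (EuclideanSpace ℝ (Fin n))} {f : EuclideanSpace ℝ (Fin n) → ℂ}
    (hf : Integrable f (diracComb S)) :
    HasSum (fun x : S => f x) (∫ x, f x ∂diracComb S) := by
  have := hasSum_integral_measure hf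
  simpa only [integral_dirac] using! this

end Measures

/-! ### Lattices, dual lattices, and Poisson summation -/

section Lattices

variable {n : ℕ}

theorem exists_pos_le_dist_of_discrete (Λ : Submodule ℤ (EuclideanSpace ℝ (Fin n)))
    [DiscreteTopology Λ] :
    ∃ r : ℝ, 0 < r ∧ ∀ x ∈ Λ, ∀ y ∈ Λ, x ≠ y → r ≤ dist x y := by
  have hd : IsDiscrete (Λ : Set (EuclideanSpace ℝ (Fin n))) := ⟨‹DiscreteTopology Λ›⟩
  obtain ⟨r, hr, h⟩ := Metric.exists_ball_inter_eq_singleton_of_mem_discrete hd Λ.zero_mem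
  refine ⟨r, hr, fun x hx y hy hxy => ?_⟩
  by_contra hlt
  have hmem : x - y ∈ Metric.ball (0 : EuclideanSpace ℝ (Fin n)) r ∩ Λ :=
    ⟨by simpa [dist_eq_norm] using hlt, Λ.sub_mem hx hy⟩
  rw [h] at hmem
  exact hxy (sub_eq_zero.1 hmem)

theorem exists_basis_span_eq (Λ : Submodule ℤ (EuclideanSpace ℝ (Fin n)))
    [DiscreteTopology Λ] [IsZLattice ℝ Λ] :
    ∃ B : Module.Basis (Fin n) ℝ (EuclideanSpace ℝ (Fin n)), Submodule.span ℤ (Set.range B) = Λ ∧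
      volume.real (ZSpan.fundamentalDomain B) = ZLattice.covolume Λ := by
  have hrank : Module.finrank ℤ Λ = n := by
    rw [ZLattice.rank ℝ Λ, finrank_euclideanSpace_fin]
  have b : Module.Basis (Fin n) ℤ Λ := Module.finBasisOfFinrankEq ℤ Λ hrank
  exact ⟨b.ofZLatticeBasis ℝ Λ, b.ofZLatticeBasis_span ℝ Λ,
    (ZLattice.covolume_eq_measure_fundamentalDomain Λ volume
      (ZLattice.isAddFundamentalDomain b volume)).symm⟩

variable (B : Module.Basis (Fin n) ℝ (EuclideanSpace ℝ (Fin n)))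

theorem mem_dualLattice_span_iff {y : EuclideanSpace ℝ (Fin n)} :
    y ∈ dualLattice (Submodule.span ℤ (Set.range B)) ↔ ∀ i, ∃ m : ℤ, inner ℝ y (B i) = (m : ℝ) := by
  refine ⟨fun h i => h _ (Submodule.subset_span ⟨i, rfl⟩), fun h x hx => ?_⟩
  induction hx using Submodule.span_induction with
  | mem x hx =>
    obtain ⟨i, rfl⟩ := hx
    exact h i
  | zero => exact ⟨0, by simp⟩
  | add x x' _ _ hx hx' =>
    obtain ⟨a, ha⟩ := hx
    obtain ⟨b, hb⟩ := hx'
    exact ⟨a + b, by rw [inner_add_right, ha, hb]; push_cast; rfl⟩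
  | smul c x _ hx =>
    obtain ⟨a, ha⟩ := hx
    refine ⟨c * a, ?_⟩
    rw [← Int.cast_smul_eq_zsmul ℝ, inner_smul_right, ha]
    push_cast
    rfl

theorem exists_unique_inner_basis (c : Fin n → ℝ) :
    ∃! y : EuclideanSpace ℝ (Fin n), ∀ i, inner ℝ y (B i) = c i := by
  refine ⟨(InnerProductSpace.toDual ℝ _).symm (LinearMap.toContinuousLinearMap (B.constr ℝ c)),
    fun i => ?_, fun z hz => ?_⟩
  · rw [InnerProductSpace.toDual_symm_apply]
    exact B.constr_basis ℝ c i
  · refine (InnerProductSpace.toDual ℝ _).injective ?_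
    rw [LinearIsometryEquiv.apply_symm_apply]
    refine ContinuousLinearMap.coe_injective (B.ext fun i => ?_)
    simpa [B.constr_basis] using hz i

/-- Distinct dual points have different integer inner products with some basis vector, so these
differ by at least `1`; Cauchy–Schwarz then separates the points. -/
theorem exists_pos_le_dist_of_dual (Λ : Submodule ℤ (EuclideanSpace ℝ (Fin n)))
    [DiscreteTopology Λ] [IsZLattice ℝ Λ] :
    ∃ r : ℝ, 0 < r ∧ ∀ x ∈ dualLattice Λ, ∀ y ∈ dualLattice Λ, x ≠ y → r ≤ dist x y := by
  obtain ⟨B, hB, -⟩ := exists_basis_span_eq Λ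
  subst hB
  have hpos : 0 < 1 + ∑ i, ‖B i‖ := by positivity
  refine ⟨(1 + ∑ i, ‖B i‖)⁻¹, by positivity, fun x hx y hy hxy => ?_⟩
  rw [mem_dualLattice_span_iff] at hx hy
  have : ∃ i, inner ℝ (x - y) (B i) ≠ 0 := by
    by_contra! h
    refine hxy ((exists_unique_inner_basis B fun i => inner ℝ y (B i)).unique (fun i => ?_)
      fun i => rfl)
    have := h i
    rwa [inner_sub_left, sub_eq_zero] at this
  obtain ⟨i, hi⟩ := this
  obtain ⟨a, ha⟩ := hx i
  obtain ⟨b, hb⟩ := hy i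
  rw [inner_sub_left, ha, hb, ← Int.cast_sub, Int.cast_ne_zero] at hi
  have h1 : (1 : ℝ) ≤ |inner ℝ (x - y) (B i)| := by
    rw [inner_sub_left, ha, hb, ← Int.cast_sub, ← Int.cast_abs]
    exact_mod_cast Int.one_le_abs hi
  have h2 := abs_real_inner_le_norm (x - y) (B i)
  have h3 : ‖B i‖ ≤ 1 + ∑ i, ‖B i‖ := by
    have := Finset.single_le_sum (f := fun i => ‖B i‖) (fun i _ => norm_nonneg _) (Finset.mem_univ i)
    linarith
  rw [dist_eq_norm, inv_le_iff_one_le_mul₀ hpos]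
  calc (1 : ℝ) ≤ ‖x - y‖ * ‖B i‖ := h1.trans h2
    _ ≤ _ := by gcongr

/-- The points of the dual lattice, indexed by integer vectors. -/
theorem exists_equiv_dualLattice :
    ∃ e : (Fin n → ℤ) ≃ dualLattice (Submodule.span ℤ (Set.range B)),
      ∀ m i, inner ℝ (e m : EuclideanSpace ℝ (Fin n)) (B i) = -(m i : ℝ) := by
  -- The minus sign matches the character of index `-m` in the definition of the `m`-th Fourier
  -- coefficient, so that the inverse transform at `e m` appears there.
  choose y hy huniq using fun m : Fin n → ℤ => exists_unique_inner_basis B fun i => -(m i : ℝ)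
  have hmem : ∀ m, y m ∈ dualLattice (Submodule.span ℤ (Set.range B)) := fun m => by
    rw [mem_dualLattice_span_iff]
    exact fun i => ⟨-m i, by rw [hy m i]; push_cast; rfl⟩
  refine ⟨Equiv.ofBijective (fun m => ⟨y m, hmem m⟩) ⟨fun m m' h => ?_, fun z => ?_⟩, hy⟩
  · have h' : y m = y m' := congrArg Subtype.val h
    funext i
    have h1 := hy m i
    rw [h', hy m' i] at h1
    exact_mod_cast (neg_injective h1).symm
  · have hz := (mem_dualLattice_span_iff B).1 z.2
    choose c hc using hz
    refine ⟨fun i => -c i, Subtype.ext (huniq _ _ fun i => ?_).symm⟩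
    rw [hc i]
    push_cast
    ring

/-- A Schwartz function is summable over a lattice, locally uniformly in its translates. -/
theorem exists_summable_bound {S : Set (EuclideanSpace ℝ (Fin n))}
    (hS : IsBallBounded (diracComb S)) (h : 𝓢(EuclideanSpace ℝ (Fin n), ℂ)) :
    ∃ (N : ℕ) (u : S → ℝ), Summable u ∧
      ∀ v (x : S), ‖h (v + x)‖ ≤ (1 + ‖v‖) ^ N * u x := by
  have := hS.hasTemperateGrowth
  set N := (diracComb S).integrablePower
  set C := 2 ^ N * ((Finset.Iic (N, 0)).sup fun m => SchwartzMap.seminorm ℂ m.1 m.2) h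
  have hsum : Summable fun x : S => (1 + ‖(x : EuclideanSpace ℝ (Fin n))‖) ^ (-(N : ℝ)) := by
    have h1 := (hasSum_integral_measure (Measure.integrable_pow_neg_integrablePower (diracComb S))).summable
    simpa only [integral_dirac] using h1
  refine ⟨N, fun x => C * (1 + ‖(x : EuclideanSpace ℝ (Fin n))‖) ^ (-(N : ℝ)), hsum.mul_left C,
    fun v x => ?_⟩
  have h1 := SchwartzMap.one_add_le_sup_seminorm_apply (𝕜 := ℂ) (m := (N, 0)) (k := N) (n := 0)
    le_rfl le_rfl h (v + x)
  rw [norm_iteratedFDeriv_zero] at h1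
  have hx : 0 < 1 + ‖(x : EuclideanSpace ℝ (Fin n))‖ := by positivity
  -- Peetre's inequality: it trades decay in `v + x` for decay in `x`, at polynomial cost in `v`.
  have h2 : 1 + ‖(x : EuclideanSpace ℝ (Fin n))‖ ≤ (1 + ‖v‖) * (1 + ‖v + x‖) := by
    have h3 := norm_sub_le (v + x) v
    rw [add_sub_cancel_left] at h3
    nlinarith [norm_nonneg v, norm_nonneg (v + (x : EuclideanSpace ℝ (Fin n)))]
  beta_reduce
  rw [Real.rpow_neg hx.le, Real.rpow_natCast, ← mul_assoc, ← div_eq_mul_inv,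
    le_div_iff₀ (by positivity)]
  calc ‖h (v + x)‖ * (1 + ‖(x : EuclideanSpace ℝ (Fin n))‖) ^ N
      ≤ ‖h (v + x)‖ * ((1 + ‖v‖) * (1 + ‖v + x‖)) ^ N := by gcongr
    _ = (1 + ‖v‖) ^ N * ((1 + ‖v + x‖) ^ N * ‖h (v + x)‖) := by
        rw [mul_pow]; ring
    _ ≤ _ := by gcongr

end Lattices

/-! ### Poisson summation, via Fourier series on the torus -/

section Poisson

variable {n : ℕ} (B : Module.Basis (Fin n) ℝ (EuclideanSpace ℝ (Fin n)))

theorem isBallBounded_span :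
    IsBallBounded (diracComb (Submodule.span ℤ (Set.range B) : Set (EuclideanSpace ℝ (Fin n)))) := by
  obtain ⟨r, hr, h⟩ := exists_pos_le_dist_of_discrete (Submodule.span ℤ (Set.range B))
  exact isBallBounded_diracComb hr h

theorem isBallBounded_dual_span :
    IsBallBounded (diracComb (dualLattice (Submodule.span ℤ (Set.range B)))) := by
  obtain ⟨r, hr, h⟩ := exists_pos_le_dist_of_dual (Submodule.span ℤ (Set.range B))
  exact isBallBounded_diracComb hr h

/-- The periodization of a function over the lattice spanned by `B`. -/
noncomputable def periodization (h : EuclideanSpace ℝ (Fin n) → ℂ) (v : EuclideanSpace ℝ (Fin n)) : ℂ :=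
  ∑' x : Submodule.span ℤ (Set.range B), h (v + x)

theorem continuous_periodization (h : 𝓢(EuclideanSpace ℝ (Fin n), ℂ)) :
    Continuous (periodization B h) := by
  obtain ⟨N, u, hu, hb⟩ := exists_summable_bound (isBallBounded_span B) h
  have hu0 : ∀ x, 0 ≤ u x := fun x => by
    have := hb 0 x
    simp only [norm_zero, add_zero, one_pow, one_mul] at this
    exact (norm_nonneg _).trans this
  refine continuous_iff_continuousAt.2 fun v => ?_
  have hcont : ContinuousOn (periodization B h) (Metric.ball v 1) := by
    refine continuousOn_tsum (u := fun x => (1 + (‖v‖ + 1)) ^ N * u x) (fun x => ?_)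
      (hu.mul_left _) fun x w hw => ?_
    · exact (h.continuous.comp (continuous_id.add continuous_const)).continuousOn
    · refine (hb w x).trans ?_
      have h1 : ‖w‖ ≤ ‖v‖ + 1 := by
        have h2 : ‖w - v‖ < 1 := by rwa [Metric.mem_ball, dist_eq_norm] at hw
        have := norm_add_le v (w - v)
        rw [add_sub_cancel] at this
        linarith
      have := hu0 x
      gcongr
  exact hcont.continuousAt (Metric.ball_mem_nhds v one_pos)

theorem periodization_add (h : EuclideanSpace ℝ (Fin n) → ℂ) (v : EuclideanSpace ℝ (Fin n))
    {x : EuclideanSpace ℝ (Fin n)} (hx : x ∈ Submodule.span ℤ (Set.range B)) :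
    periodization B h (v + x) = periodization B h v := by
  refine Eq.trans (tsum_congr fun y => ?_) ((Equiv.addLeft
    (⟨x, hx⟩ : Submodule.span ℤ (Set.range B))).tsum_eq
      fun y : Submodule.span ℤ (Set.range B) => h (v + y))
  simp [add_assoc]

/-- Unfolding the integral of a periodization against a character. -/
theorem setIntegral_periodization (h : 𝓢(EuclideanSpace ℝ (Fin n), ℂ))
    {y : EuclideanSpace ℝ (Fin n)} (hy : y ∈ dualLattice (Submodule.span ℤ (Set.range B))) :
    ∫ v in ZSpan.fundamentalDomain B,
        Complex.exp (↑(2 * Real.pi * inner ℝ v y) * Complex.I) * periodization B h v = 𝓕⁻ h y := by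
  set L := Submodule.span ℤ (Set.range B) with hL
  set g : EuclideanSpace ℝ (Fin n) → ℂ :=
    fun v => Complex.exp (↑(2 * Real.pi * inner ℝ v y) * Complex.I) * h v with hg
  have hgc : Continuous g := by
    have := h.continuous
    fun_prop
  have hgi : Integrable g := by
    refine (h.integrable (μ := volume)).mono hgc.aestronglyMeasurable (Eventually.of_forall fun v => ?_)
    simp only [hg]
    rw [norm_mul, Complex.norm_exp_ofReal_mul_I, one_mul]
  have hfd := ZSpan.isAddFundamentalDomain B (volume : Measure (EuclideanSpace ℝ (Fin n)))
  have : VAddInvariantMeasure L (EuclideanSpace ℝ (Fin n)) volume :=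
    (inferInstance : VAddInvariantMeasure L.toAddSubgroup (EuclideanSpace ℝ (Fin n)) volume)
  -- As `y` is dual to the lattice, a lattice translation leaves the character unchanged.
  have hper : ∀ (x : L) v, g (x +ᵥ v) =
      Complex.exp (↑(2 * Real.pi * inner ℝ v y) * Complex.I) * h (v + x) := by
    intro x v
    obtain ⟨m, hm⟩ := hy x x.2
    have h1 : inner ℝ ((x : EuclideanSpace ℝ (Fin n)) + v) y = m + inner ℝ v y := by
      rw [inner_add_left, real_inner_comm, hm]
    simp only [hg, Submodule.vadd_def, vadd_eq_add, h1]
    rw [add_comm (x : EuclideanSpace ℝ (Fin n)) v]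
    congr 1
    have : ((2 * Real.pi * (m + inner ℝ v y) : ℝ) : ℂ) * Complex.I =
        ↑(2 * Real.pi * inner ℝ v y) * Complex.I + m * (2 * Real.pi * Complex.I) := by
      push_cast
      ring
    rw [this, Complex.exp_add, Complex.exp_int_mul_two_pi_mul_I, mul_one]
  have h1 : ∀ v, Complex.exp (↑(2 * Real.pi * inner ℝ v y) * Complex.I) * periodization B h v =
      ∑' x : L, g (x +ᵥ v) := fun v => by
    rw [periodization, ← tsum_mul_left]
    exact tsum_congr fun x => (hper x v).symm
  simp only [h1]
  rw [integral_tsum]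
  · rw [← hfd.integral_eq_tsum'' g hgi, SchwartzMap.fourierInv_coe, Real.fourierInv_eq']
    rfl
  · intro x
    refine Continuous.aestronglyMeasurable ?_
    have : Continuous fun v : EuclideanSpace ℝ (Fin n) => (x : EuclideanSpace ℝ (Fin n)) + v := by
      fun_prop
    exact hgc.comp this
  · rw [← hfd.lintegral_eq_tsum'' fun v => ‖g v‖ₑ]
    exact hgi.2.ne

/-- The quotient map from Euclidean space to the torus. -/
theorem isOpenQuotientMap_torus :
    IsOpenQuotientMap (fun (t : Fin n → ℝ) i => (t i : UnitAddCircle)) :=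
  IsOpenQuotientMap.piMap fun _ => QuotientAddGroup.isOpenQuotientMap_mk

/-- The periodization of a Schwartz function as a function on the torus. -/
theorem exists_torus_periodization (h : 𝓢(EuclideanSpace ℝ (Fin n), ℂ)) :
    ∃ F : C(UnitAddTorus (Fin n), ℂ), ∀ t : Fin n → ℝ,
      F (fun i => (t i : UnitAddCircle)) = periodization B h (B.equivFunL.symm t) := by
  have hq := isOpenQuotientMap_torus (n := n)
  -- An arbitrary section of the quotient map suffices: two lifts differ by an integer vector,
  -- invisible to the periodization, and continuity descends along the quotient.
  choose s hs using hq.surjective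
  have key : ∀ t : Fin n → ℝ,
      periodization B h (B.equivFunL.symm (s fun i => (t i : UnitAddCircle))) =
        periodization B h (B.equivFunL.symm t) := by
    intro t
    set t' := s fun i => (t i : UnitAddCircle) with ht'
    have h1 : ∀ i, ∃ m : ℤ, (m : ℝ) = t' i - t i := fun i => by
      have h2 := congrFun (hs fun i => (t i : UnitAddCircle)) i
      rw [QuotientAddGroup.eq_iff_sub_mem] at h2
      obtain ⟨m, hm⟩ := AddSubgroup.mem_zmultiples_iff.1 h2
      exact ⟨m, by simpa using hm⟩
    have h2 : B.equivFunL.symm t' - B.equivFunL.symm t ∈ Submodule.span ℤ (Set.range B) := by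
      rw [← map_sub, Module.Basis.mem_span_iff_repr_mem]
      intro i
      obtain ⟨m, hm⟩ := h1 i
      refine ⟨m, ?_⟩
      have : B.repr (B.equivFunL.symm (t' - t)) i = (t' - t) i :=
        congrFun (B.equivFunL.apply_symm_apply (t' - t)) i
      rw [this, Pi.sub_apply, ← hm]
      rfl
    have h3 := periodization_add B h (B.equivFunL.symm t) h2
    rwa [add_sub_cancel] at h3
  refine ⟨⟨fun z => periodization B h (B.equivFunL.symm (s z)), ?_⟩, key⟩
  rw [hq.isQuotientMap.continuous_iff]
  have : (fun z => periodization B h (B.equivFunL.symm (s z))) ∘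
      (fun (t : Fin n → ℝ) i => (t i : UnitAddCircle)) =
      fun t => periodization B h (B.equivFunL.symm t) := funext key
  rw [this]
  exact (continuous_periodization B h).comp B.equivFunL.symm.continuous

/-- Integration in the coordinates of a basis. -/
theorem setIntegral_comp_equivFunL_symm (G : EuclideanSpace ℝ (Fin n) → ℂ) :
    ∫ t in Set.univ.pi fun _ : Fin n => Set.Ico (0 : ℝ) 1, G (B.equivFunL.symm t) =
      ((volume.real (ZSpan.fundamentalDomain B))⁻¹ : ℝ) • ∫ v in ZSpan.fundamentalDomain B, G v := by
  have hpre : B.equivFunL.symm ⁻¹' ZSpan.fundamentalDomain B =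
      Set.univ.pi fun _ : Fin n => Set.Ico (0 : ℝ) 1 := by
    ext t
    simp only [Set.mem_preimage, ZSpan.mem_fundamentalDomain, Set.mem_pi, Set.mem_univ, true_imp_iff]
    refine forall_congr' fun i => ?_
    have : B.repr (B.equivFunL.symm t) i = t i := congrFun (B.equivFunL.apply_symm_apply t) i
    rw [this]
  set e := B.equivFunL.symm.toHomeomorph.toMeasurableEquiv with he
  have hee : ∀ t, e t = B.equivFunL.symm t := fun t => rfl
  have hhaar : (Measure.map e (volume : Measure (Fin n → ℝ))).IsAddHaarMeasure :=
    B.equivFunL.symm.isAddHaarMeasure_map volume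
  -- Uniqueness of Haar measure up to scaling; `c` is then determined by the fundamental cell, whose
  -- preimage is the unit cube.
  obtain ⟨c, hc⟩ : ∃ c : ℝ≥0∞, Measure.map e (volume : Measure (Fin n → ℝ)) = c • volume :=
    ⟨_, Measure.isAddLeftInvariant_eq_smul _ _⟩
  have hone : (Measure.map e (volume : Measure (Fin n → ℝ))) (ZSpan.fundamentalDomain B) = 1 := by
    rw [e.map_apply]
    change volume (B.equivFunL.symm ⁻¹' _) = 1
    rw [hpre, Real.volume_pi_Ico]
    simp
  have hcV : c.toReal * volume.real (ZSpan.fundamentalDomain B) = 1 := by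
    have := congrArg ENNReal.toReal hone
    rw [hc, Measure.smul_apply, smul_eq_mul, ENNReal.toReal_mul] at this
    simpa [Measure.real] using this
  have hcr : c.toReal = (volume.real (ZSpan.fundamentalDomain B))⁻¹ := eq_inv_of_mul_eq_one_left hcV
  have h1 := setIntegral_map_equiv (μ := (volume : Measure (Fin n → ℝ))) e G
    (ZSpan.fundamentalDomain B)
  rw [hc, Measure.restrict_smul, integral_smul_measure, hcr] at h1
  rw [h1, ← hpre]
  rfl

theorem mFourierCoeff_periodization (h : 𝓢(EuclideanSpace ℝ (Fin n), ℂ))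
    {F : C(UnitAddTorus (Fin n), ℂ)} (hF : ∀ t : Fin n → ℝ,
      F (fun i => (t i : UnitAddCircle)) = periodization B h (B.equivFunL.symm t))
    {m : Fin n → ℤ} {y : EuclideanSpace ℝ (Fin n)} (hy : ∀ i, inner ℝ y (B i) = -(m i : ℝ)) :
    UnitAddTorus.mFourierCoeff F m =
      ((volume.real (ZSpan.fundamentalDomain B))⁻¹ : ℝ) • 𝓕⁻ h y := by
  have hyd : y ∈ dualLattice (Submodule.span ℤ (Set.range B)) := by
    rw [mem_dualLattice_span_iff]
    exact fun i => ⟨-m i, by rw [hy i]; push_cast; rfl⟩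
  rw [← setIntegral_periodization B h hyd, ← setIntegral_comp_equivFunL_symm,
    UnitAddTorus.mFourierCoeff_eq_integral _ _ 0]
  have hset : {x : Fin n → ℝ | ∀ i, x i ∈ Set.Ioc ((0 : Fin n → ℝ) i) ((0 : Fin n → ℝ) i + 1)} =
      Set.univ.pi fun _ : Fin n => Set.Ioc (0 : ℝ) 1 := by
    ext t
    simp
  -- The Fourier coefficient uses cubes half open on the left, the fundamental domain cubes half
  -- open on the right; they differ by a null set.
  have hae : (Set.univ.pi fun _ : Fin n => Set.Ioc (0 : ℝ) 1) =ᵐ[volume]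
      Set.univ.pi fun _ : Fin n => Set.Ico (0 : ℝ) 1 :=
    Measure.univ_pi_Ioc_ae_eq_Icc.trans Measure.univ_pi_Ico_ae_eq_Icc.symm
  rw [hset, setIntegral_congr_set hae]
  refine integral_congr_ae (Eventually.of_forall fun t => ?_)
  simp only [smul_eq_mul]
  rw [hF t]
  congr 1
  have hin : inner ℝ (B.equivFunL.symm t) y = -∑ i, (m i : ℝ) * t i := by
    have : B.equivFunL.symm t = ∑ i, t i • B i := B.equivFun_symm_apply t
    rw [this, sum_inner, ← Finset.sum_neg_distrib]
    refine Finset.sum_congr rfl fun i _ => ?_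
    rw [real_inner_smul_left, real_inner_comm, hy i]
    ring
  rw [hin]
  change ∏ i, fourier ((-m) i) (t i : UnitAddCircle) = _
  simp only [fourier_coe_apply, ← Complex.exp_sum]
  congr 1
  push_cast
  rw [mul_neg, neg_mul, Finset.mul_sum, Finset.sum_mul, ← Finset.sum_neg_distrib]
  refine Finset.sum_congr rfl fun i _ => ?_
  simp
  ring

/-- **Poisson summation** for the lattice spanned by a basis. -/
theorem poisson_summation (h : 𝓢(EuclideanSpace ℝ (Fin n), ℂ)) :
    ∑' x : Submodule.span ℤ (Set.range B), h x =
      ((volume.real (ZSpan.fundamentalDomain B))⁻¹ : ℝ) •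
        ∑' y : dualLattice (Submodule.span ℤ (Set.range B)), 𝓕⁻ h y := by
  obtain ⟨F, hF⟩ := exists_torus_periodization B h
  obtain ⟨e, he⟩ := exists_equiv_dualLattice B
  obtain ⟨g, hg⟩ : ∃ g : 𝓢(EuclideanSpace ℝ (Fin n), ℂ), g = 𝓕⁻ h := ⟨_, rfl⟩
  rw [← hg]
  have hcoeff : ∀ m, UnitAddTorus.mFourierCoeff F m =
      ((volume.real (ZSpan.fundamentalDomain B))⁻¹ : ℝ) • g (e m) := fun m => by
    rw [hg]
    exact mFourierCoeff_periodization B h hF (he m)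
  have hsum : Summable fun y : dualLattice (Submodule.span ℤ (Set.range B)) => g y := by
    have := (isBallBounded_dual_span B).hasTemperateGrowth
    have hi : Integrable g (diracComb (dualLattice (Submodule.span ℤ (Set.range B)))) :=
      g.integrable
    exact (integral_diracComb hi).summable
  have hsume : HasSum (UnitAddTorus.mFourierCoeff F)
      (((volume.real (ZSpan.fundamentalDomain B))⁻¹ : ℝ) •
        ∑' y : dualLattice (Submodule.span ℤ (Set.range B)), g y) := by
    have h1 := ((e.hasSum_iff (f := fun y : dualLattice (Submodule.span ℤ (Set.range B)) => g y)).2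
      hsum.hasSum).const_smul ((volume.real (ZSpan.fundamentalDomain B))⁻¹ : ℝ)
    exact HasSum.congr_fun h1 hcoeff
  -- Summable coefficients make the Fourier series of the continuous function `F` converge to it
  -- pointwise; at the origin all characters equal `1`.
  have h1 := UnitAddTorus.hasSum_mFourier_series_apply_of_summable hsume.summable
    (fun i => ((0 : Fin n → ℝ) i : UnitAddCircle))
  have h2 : F (fun i => ((0 : Fin n → ℝ) i : UnitAddCircle)) =
      ∑' x : Submodule.span ℤ (Set.range B), h x := by
    rw [hF 0, map_zero, periodization]
    exact tsum_congr fun x => by rw [zero_add]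
  rw [← h2]
  refine h1.unique ?_
  refine hsume.congr_fun fun m => ?_
  have h3 : UnitAddTorus.mFourier m (fun i => ((0 : Fin n → ℝ) i : UnitAddCircle)) = 1 := by
    change ∏ i, fourier (m i) (((0 : Fin n → ℝ) i : ℝ) : UnitAddCircle) = 1
    refine Finset.prod_eq_one fun i _ => ?_
    exact fourier_eval_zero (m i)
  rw [h3, smul_eq_mul, mul_one]

end Poisson

/-! ### The two series of weighted combs, dual to each other term by term -/

section Series

variable {n : ℕ} (Λ : Submodule ℤ (EuclideanSpace ℝ (Fin n)))

/-- The set of `m`-fold multiples of the points of `Λ`. -/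
def multiples (m : ℕ) : Set (EuclideanSpace ℝ (Fin n)) := {x | ∃ y ∈ Λ, m • y = x}

variable {Λ} in
theorem multiples_subset (m : ℕ) : multiples Λ m ⊆ Λ := by
  rintro _ ⟨y, hy, rfl⟩
  exact Λ.smul_of_tower_mem m hy

/-- Poisson summation for the lattice `m Λ`. -/
theorem poisson_summation_multiples [DiscreteTopology Λ] [IsZLattice ℝ Λ] {m : ℕ} (hm : m ≠ 0)
    (h : 𝓢(EuclideanSpace ℝ (Fin n), ℂ)) :
    ∑' x : multiples Λ m, h x = ((ZLattice.covolume Λ * (m : ℝ) ^ n)⁻¹ : ℝ) •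
      ∑' y : {y | m • y ∈ dualLattice Λ}, 𝓕⁻ h (y : EuclideanSpace ℝ (Fin n)) := by
  obtain ⟨B, hB, hcov⟩ := exists_basis_span_eq Λ
  have hm' : (m : ℝ) ≠ 0 := Nat.cast_ne_zero.2 hm
  set B' := B.isUnitSMul fun _ : Fin n => hm'.isUnit with hB'
  have hBi : ∀ i, B' i = (m : ℝ) • B i := fun i => Module.Basis.isUnitSMul_apply _ i
  have hset : (Submodule.span ℤ (Set.range B') : Set (EuclideanSpace ℝ (Fin n))) =
      multiples Λ m := by
    rw [hB', ← ZSpan.smul B hm', hB]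
    ext x
    simp only [multiples, Submodule.coe_pointwise_smul, Set.mem_smul_set, Set.mem_ofPred_eq,
      SetLike.mem_coe, Nat.cast_smul_eq_nsmul]
  have hdual : dualLattice (Submodule.span ℤ (Set.range B')) = {y | m • y ∈ dualLattice Λ} := by
    ext y
    rw [Set.mem_ofPred_eq, ← hB, mem_dualLattice_span_iff, mem_dualLattice_span_iff]
    refine forall_congr' fun i => ?_
    rw [hBi, inner_smul_right, ← Nat.cast_smul_eq_nsmul ℝ, real_inner_smul_left]
  have hvol : volume.real (ZSpan.fundamentalDomain B') = ZLattice.covolume Λ * (m : ℝ) ^ n := by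
    rw [ZSpan.measureReal_fundamentalDomain B' volume B, hB', Module.Basis.det_isUnitSMul, hcov]
    simp [mul_comm]
  have key := poisson_summation B' h
  rw [hvol, hdual] at key
  rw [← key, ← hset]
  rfl

variable {Λ} in
theorem isBallBounded_multiples [DiscreteTopology Λ] (m : ℕ) :
    IsBallBounded (diracComb (multiples Λ m)) := by
  obtain ⟨r, hr, h⟩ := exists_pos_le_dist_of_discrete Λ
  exact isBallBounded_diracComb hr fun x hx y hy =>
    h x (multiples_subset m hx) y (multiples_subset m hy)

/-- Division by `m` shrinks the separation of the dual lattice to `r / m`, so packing bounds the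
count by `(2 * R / r * m + 1) ^ n` for `R ≥ 0`; as `m ≥ 1`, a factor `m ^ n` comes out. -/
theorem exists_diracComb_dual_le [DiscreteTopology Λ] [IsZLattice ℝ Λ] (R : ℝ) :
    ∃ C : ℝ≥0∞, C ≠ ∞ ∧ ∀ m : ℕ, m ≠ 0 → ∀ x,
      diracComb {y | m • y ∈ dualLattice Λ} (Metric.ball x R) ≤ C * ENNReal.ofReal ((m : ℝ) ^ n) := by
  obtain ⟨r, hr, h⟩ := exists_pos_le_dist_of_dual Λ
  refine ⟨ENNReal.ofReal ((2 * max R 0 / r + 1) ^ n), ENNReal.ofReal_ne_top, fun m hm x => ?_⟩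
  have hm1 : (1 : ℝ) ≤ m := by exact_mod_cast Nat.one_le_iff_ne_zero.2 hm
  have hm0 : (0 : ℝ) < m := by linarith
  have hR := le_max_right R 0
  have hsep : ∀ y ∈ {y | m • y ∈ dualLattice Λ}, ∀ z ∈ {y | m • y ∈ dualLattice Λ}, y ≠ z →
      r / m ≤ dist y z := by
    intro y hy z hz hyz
    have h1 := h _ hy _ hz fun he => hyz <| by
      rw [← Nat.cast_smul_eq_nsmul ℝ, ← Nat.cast_smul_eq_nsmul ℝ] at he
      exact smul_right_injective _ hm0.ne' he
    rw [← Nat.cast_smul_eq_nsmul ℝ, ← Nat.cast_smul_eq_nsmul ℝ, dist_smul₀, Real.norm_natCast] at h1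
    rwa [div_le_iff₀' hm0]
  refine (measure_mono (Metric.ball_subset_ball (le_max_left R 0))).trans
    ((diracComb_ball_le (by positivity) hsep x hR).trans ?_)
  rw [← ENNReal.ofReal_mul (by positivity), ← mul_pow]
  refine ENNReal.ofReal_le_ofReal (pow_le_pow_left₀ (by positivity) ?_ n)
  have : 2 * max R 0 / (r / m) = 2 * max R 0 / r * m := by field_simp
  rw [this]
  nlinarith

/-- The coefficient `∏_{p ∣ d} 1 / (p ^ s - 2)`. -/
noncomputable def combWeight (s d : ℕ) : ℝ := ∏ p ∈ d.primeFactors, 1 / ((p : ℝ) ^ s - 2)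

theorem combWeight_nonneg {s : ℕ} (hs : 2 ≤ s) (d : ℕ) : 0 ≤ combWeight s d :=
  Finset.prod_nonneg fun p hp => by
    have := four_le_prime_pow ⟨p, Nat.prime_of_mem_primeFactors hp⟩ hs
    exact one_div_nonneg.2 (by linarith)

theorem summable_abs_combWeight_factor {s : ℕ} (hs : 2 ≤ s) :
    Summable fun p : PrimeNat => |1 / ((p : ℝ) ^ s - 2)| := by
  refine summable_abs_of_le (g := fun p : ℕ => 1 / ((p : ℝ) ^ s - 2)) hs (C := 2) fun p => ?_
  have := four_le_prime_pow p hs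
  rw [abs_of_nonneg (one_div_nonneg.2 (by linarith)), mul_one_div,
    div_le_div_iff₀ (by linarith) (by linarith)]
  linarith

theorem summable_combWeight {s : ℕ} (hs : 2 ≤ s) :
    Summable fun d : {d : ℕ // Squarefree d} => combWeight s d :=
  summable_squarefree_prod (g := fun p : ℕ => 1 / ((p : ℝ) ^ s - 2))
    (summable_abs_combWeight_factor hs)

theorem series_coeff_nonneg {k : ℕ} (hs : 2 ≤ n * k) (d : ℕ) :
    0 ≤ ∏ p ∈ d.primeFactors, 1 / ((p : ℝ) ^ (2 * n * k) - 2 * (p : ℝ) ^ (n * k)) :=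
  Finset.prod_nonneg fun p hp => by
    rw [mul_assoc 2 n k]
    exact one_div_nonneg.2 (two_mul_pow_lt hs ⟨p, Nat.prime_of_mem_primeFactors hp⟩).le

/-- Relation between the coefficients of the diffraction and the autocorrelation. -/
theorem series_coeff_mul_pow {k : ℕ} (hs : 2 ≤ n * k) {d : ℕ} (hd : Squarefree d) :
    (∏ p ∈ d.primeFactors, 1 / ((p : ℝ) ^ (2 * n * k) - 2 * (p : ℝ) ^ (n * k))) *
      ((d ^ k : ℕ) : ℝ) ^ n = combWeight (n * k) d := by
  have h3 : ((d ^ k : ℕ) : ℝ) ^ n = ∏ p ∈ d.primeFactors, (p : ℝ) ^ (n * k) := by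
    conv_lhs => rw [← Nat.prod_primeFactors_of_squarefree hd]
    rw [Nat.cast_pow, Nat.cast_prod, Finset.prod_pow, ← pow_mul, mul_comm k n]
  rw [h3, combWeight, ← Finset.prod_mul_distrib]
  refine Finset.prod_congr rfl fun p hp => ?_
  have h4 := four_le_prime_pow ⟨p, Nat.prime_of_mem_primeFactors hp⟩ hs
  simp only at h4
  have h0 : (p : ℝ) ^ (n * k) ≠ 0 := by linarith
  have h20 : (p : ℝ) ^ (n * k) - 2 ≠ 0 := by linarith
  rw [mul_assoc 2 n k, show (p : ℝ) ^ (2 * (n * k)) - 2 * (p : ℝ) ^ (n * k) =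
    (p : ℝ) ^ (n * k) * ((p : ℝ) ^ (n * k) - 2) by ring]
  field_simp

/-- The term of the autocorrelation carried by the lattice `d ^ k Λ`. -/
noncomputable def autocorrelationTerm (k d : ℕ) : Measure (EuclideanSpace ℝ (Fin n)) :=
  ENNReal.ofReal (xi (n * k) / ZLattice.covolume Λ * combWeight (n * k) d) •
    diracComb (multiples Λ (d ^ k))

/-- The sublattices `d ^ k Λ` inherit the separation of `Λ`, so one packing constant serves all `d`
and the coefficients themselves are summable. -/
theorem isUniformlySummable_autocorrelationTerm [DiscreteTopology Λ] [IsZLattice ℝ Λ] {k : ℕ}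
    (hs : 2 ≤ n * k) :
    IsUniformlySummable fun d : {d : ℕ // Squarefree d} => autocorrelationTerm Λ k d := by
  refine ⟨fun d => ENNReal.ofReal (xi (n * k) / ZLattice.covolume Λ * combWeight (n * k) d),
    ((summable_combWeight hs).mul_left _).tsum_ofReal_ne_top, fun R => ?_⟩
  obtain ⟨r, hr, h⟩ := exists_pos_le_dist_of_discrete Λ
  refine ⟨ENNReal.ofReal ((2 * max R 0 / r + 1) ^ n), ENNReal.ofReal_ne_top, fun d x => ?_⟩
  beta_reduce
  rw [autocorrelationTerm, Measure.smul_apply, smul_eq_mul, mul_comm]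
  gcongr
  refine (measure_mono (Metric.ball_subset_ball (le_max_left R 0))).trans
    (diracComb_ball_le hr (fun y hy z hz => ?_) x (le_max_right R 0))
  exact h y (multiples_subset _ hy) z (multiples_subset _ hz)

/-- Here the combs become denser with `d`, at the rate `(d ^ k) ^ n`; the coefficients compensate
this exactly, leaving `combWeight` once more. -/
theorem isUniformlySummable_diffractionTerm [DiscreteTopology Λ] [IsZLattice ℝ Λ] {k : ℕ}
    (hs : 2 ≤ n * k) :
    IsUniformlySummable fun d : {d : ℕ // Squarefree d} => diffractionTerm Λ k d := by
  refine ⟨fun d => ENNReal.ofReal (xi (n * k) / ZLattice.covolume Λ ^ 2 * combWeight (n * k) d),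
    ((summable_combWeight hs).mul_left _).tsum_ofReal_ne_top, fun R => ?_⟩
  obtain ⟨C, hC, h⟩ := exists_diracComb_dual_le Λ R
  refine ⟨C, hC, fun d x => ?_⟩
  beta_reduce
  rw [diffractionTerm, Measure.smul_apply, smul_eq_mul]
  refine (mul_le_mul_right (h _ (pow_ne_zero k d.2.ne_zero) x) _).trans (le_of_eq ?_)
  have h1 := series_coeff_nonneg (n := n) (k := k) hs d
  have h2 := xi_pos hs
  rw [mul_left_comm, ← ENNReal.ofReal_mul (by positivity), ← series_coeff_mul_pow hs d.2]
  congr 2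
  ring

/-- The Fourier transform of a single term of the autocorrelation. -/
theorem integral_fourier_autocorrelationTerm [DiscreteTopology Λ] [IsZLattice ℝ Λ] {k : ℕ}
    (hs : 2 ≤ n * k) {d : ℕ} (hd : Squarefree d) (f : 𝓢(EuclideanSpace ℝ (Fin n), ℂ)) :
    ∫ x, (𝓕 f) x ∂autocorrelationTerm Λ k d = ∫ x, f x ∂diffractionTerm Λ k d := by
  have hd0 : d ^ k ≠ 0 := pow_ne_zero k hd.ne_zero
  obtain ⟨g, hg⟩ : ∃ g : 𝓢(EuclideanSpace ℝ (Fin n), ℂ), g = 𝓕 f := ⟨_, rfl⟩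
  -- Poisson summation is applied to `g = 𝓕 f`, so that `f` itself appears on the dual side.
  have hfg : f = 𝓕⁻ g := by rw [hg, FourierTransform.fourierInv_fourier_eq]
  rw [← hg, autocorrelationTerm, diffractionTerm, integral_smul_measure, integral_smul_measure]
  have hi1 : Integrable g (diracComb (multiples Λ (d ^ k))) := by
    have := (isBallBounded_multiples (Λ := Λ) (d ^ k)).hasTemperateGrowth
    exact g.integrable
  have hi2 : Integrable f (diracComb {y | d ^ k • y ∈ dualLattice Λ}) := by
    have : IsBallBounded (diracComb {y | d ^ k • y ∈ dualLattice Λ}) := fun R => by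
      obtain ⟨C, hC, h⟩ := exists_diracComb_dual_le Λ R
      exact ⟨_, ENNReal.mul_ne_top hC ENNReal.ofReal_ne_top, h _ hd0⟩
    have := this.hasTemperateGrowth
    exact f.integrable
  rw [← (integral_diracComb hi1).tsum_eq, ← (integral_diracComb hi2).tsum_eq,
    poisson_summation_multiples Λ hd0 g, ← hfg, smul_smul]
  congr 1
  have hcov := ZLattice.covolume_pos Λ volume
  have h1 := series_coeff_nonneg (n := n) (k := k) hs d
  have h2 := xi_pos hs
  have h3 := combWeight_nonneg hs d
  have hdk : (0 : ℝ) < ((d ^ k : ℕ) : ℝ) ^ n := by positivity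
  rw [ENNReal.toReal_ofReal (by positivity), ENNReal.toReal_ofReal (by positivity),
    ← series_coeff_mul_pow hs hd]
  field_simp

/-- The sum of the terms of the autocorrelation and its Fourier transform. -/
theorem isFourierTransformOf_sum [DiscreteTopology Λ] [IsZLattice ℝ Λ] {k : ℕ} (hs : 2 ≤ n * k) :
    IsFourierTransformOf
      (Measure.sum fun d : {d : ℕ // Squarefree d} => diffractionTerm Λ k d)
      (Measure.sum fun d : {d : ℕ // Squarefree d} => autocorrelationTerm Λ k d) := by
  have h1 := (isUniformlySummable_autocorrelationTerm Λ hs).isBallBounded_sum.hasTemperateGrowth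
  have h2 := (isUniformlySummable_diffractionTerm Λ hs).isBallBounded_sum.hasTemperateGrowth
  refine ⟨h1, h2, ?_⟩
  ext f
  change ∫ x, (𝓕 f) x ∂_ = ∫ x, f x ∂_
  rw [integral_sum_measure (SchwartzMap.integrable _), integral_sum_measure (SchwartzMap.integrable _)]
  exact tsum_congr fun d => integral_fourier_autocorrelationTerm Λ hs d.2 f

end Series

/-! ### Densities of sets of lattice points -/

section Density

variable {n : ℕ}

/-- The natural density of a point set along balls centred at the origin. -/
def HasDensity (A : Set (EuclideanSpace ℝ (Fin n))) (δ : ℝ) : Prop :=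
  Tendsto (fun R : ℝ => ((A ∩ Metric.ball 0 R).ncard : ℝ) /
    volume.real (Metric.ball (0 : EuclideanSpace ℝ (Fin n)) R)) atTop (𝓝 δ)

theorem volume_real_ball {R : ℝ} (hR : 0 < R) :
    volume.real (Metric.ball (0 : EuclideanSpace ℝ (Fin n)) R) =
      R ^ n * volume.real (Metric.ball (0 : EuclideanSpace ℝ (Fin n)) 1) := by
  rw [measureReal_def, Measure.addHaar_ball_of_pos _ _ hR, finrank_euclideanSpace_fin,
    ENNReal.toReal_mul, ENNReal.toReal_ofReal (by positivity)]
  rfl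

theorem volume_real_ball_one_pos :
    0 < volume.real (Metric.ball (0 : EuclideanSpace ℝ (Fin n)) 1) :=
  ENNReal.toReal_pos (Metric.measure_ball_pos _ _ one_pos).ne' measure_ball_lt_top.ne

variable (Λ : Submodule ℤ (EuclideanSpace ℝ (Fin n))) [DiscreteTopology Λ] [IsZLattice ℝ Λ]

variable {Λ} in
theorem finite_inter_of_isBounded {A s : Set (EuclideanSpace ℝ (Fin n))} (hA : A ⊆ Λ)
    (hs : Bornology.IsBounded s) : (A ∩ s).Finite := by
  obtain ⟨B, hB, -⟩ := exists_basis_span_eq Λ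
  have := ZSpan.setFinite_inter B hs
  rw [hB] at this
  exact this.subset fun x hx => ⟨hx.2, hA hx.1⟩

/-- The number of lattice points in large balls. -/
theorem tendsto_card_lattice_closedBall (hn : n ≠ 0) :
    Tendsto (fun ρ : ℝ => (((Λ : Set (EuclideanSpace ℝ (Fin n))) ∩ Metric.closedBall 0 ρ).ncard : ℝ) /
      ρ ^ n) atTop
      (𝓝 (volume.real (Metric.ball (0 : EuclideanSpace ℝ (Fin n)) 1) / ZLattice.covolume Λ)) := by
  have : Nonempty (Fin n) := ⟨⟨0, Nat.pos_of_ne_zero hn⟩⟩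
  have hset : ∀ ρ : ℝ, 0 ≤ ρ → {x ∈ (Set.univ : Set (EuclideanSpace ℝ (Fin n))) | ‖x‖ ^ n ≤ ρ ^ n} =
      Metric.closedBall 0 ρ := fun ρ hρ => by
    ext x
    simp only [Set.mem_ofPred_eq, Set.mem_univ, true_and, mem_closedBall_zero_iff]
    exact pow_le_pow_iff_left₀ (norm_nonneg x) hρ hn
  have hset1 := hset 1 zero_le_one
  rw [one_pow] at hset1
  -- The cone is the whole space and the gauge `‖x‖ ^ n` is homogeneous of degree `n`; its unit
  -- sublevel set is the closed unit ball, with null boundary.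
  have h := ZLattice.covolume.tendsto_card_le_div' Λ (X := Set.univ)
    (F := fun x : EuclideanSpace ℝ (Fin n) => ‖x‖ ^ n) (fun _ _ _ _ => Set.mem_univ _)
    (fun x r hr => by
      rw [norm_smul, mul_pow, finrank_euclideanSpace_fin, Real.norm_of_nonneg hr])
    (by rw [hset1]; exact Metric.isBounded_closedBall)
    (by rw [hset1]; exact measurableSet_closedBall)
    (by rw [hset1, frontier_closedBall _ one_ne_zero]; exact Measure.addHaar_sphere _ _ _)
  rw [hset1] at h
  have hb : volume.real (Metric.closedBall (0 : EuclideanSpace ℝ (Fin n)) 1) =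
      volume.real (Metric.ball (0 : EuclideanSpace ℝ (Fin n)) 1) := by
    rw [measureReal_def, Measure.addHaar_closedBall_eq_addHaar_ball]
    rfl
  rw [hb] at h
  refine (h.comp (tendsto_pow_atTop hn)).congr' ?_
  filter_upwards [eventually_ge_atTop 0] with ρ hρ
  simp only [Function.comp]
  rw [hset ρ hρ, Set.inter_comm, Nat.card_coe_set_eq]

/-- The coset `t + m Λ`. -/
def coset (t : EuclideanSpace ℝ (Fin n)) (m : ℕ) : Set (EuclideanSpace ℝ (Fin n)) :=
  {x | ∃ y ∈ Λ, x = t + m • y}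

/-- The fixed shift `a` of the radius does not affect the leading term; it leaves room for
translating a ball by a fixed vector. -/
theorem tendsto_card_lattice_scaled (hn : n ≠ 0) {m : ℕ} (hm : m ≠ 0) (a : ℝ) :
    Tendsto (fun R : ℝ => (((Λ : Set (EuclideanSpace ℝ (Fin n))) ∩
        Metric.closedBall 0 ((R + a) / m)).ncard : ℝ) /
      volume.real (Metric.ball (0 : EuclideanSpace ℝ (Fin n)) R)) atTop
      (𝓝 (ZLattice.covolume Λ * (m : ℝ) ^ n)⁻¹) := by
  have hm0 : (0 : ℝ) < m := by exact_mod_cast Nat.pos_of_ne_zero hm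
  have hρ : Tendsto (fun R : ℝ => (R + a) / m) atTop atTop :=
    (tendsto_atTop_add_const_right _ a tendsto_id).atTop_div_const hm0
  have h1 := (tendsto_card_lattice_closedBall Λ hn).comp hρ
  have h2 : Tendsto (fun R : ℝ => ((R + a) / m / R) ^ n) atTop (𝓝 ((1 / m) ^ n)) := by
    refine Tendsto.pow ?_ n
    have : Tendsto (fun R : ℝ => (1 + a * R⁻¹) / m) atTop (𝓝 ((1 + a * 0) / m)) :=
      ((tendsto_inv_atTop_zero.const_mul a).const_add 1).div_const _
    rw [mul_zero, add_zero] at this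
    refine this.congr' ?_
    filter_upwards [eventually_gt_atTop 0] with R hR
    field_simp
  have hV := volume_real_ball_one_pos (n := n)
  have h3 := (h1.mul h2).div_const (volume.real (Metric.ball (0 : EuclideanSpace ℝ (Fin n)) 1))
  have hcov := ZLattice.covolume_pos Λ volume
  have heq : volume.real (Metric.ball (0 : EuclideanSpace ℝ (Fin n)) 1) / ZLattice.covolume Λ *
      (1 / (m : ℝ)) ^ n / volume.real (Metric.ball (0 : EuclideanSpace ℝ (Fin n)) 1) =
      (ZLattice.covolume Λ * (m : ℝ) ^ n)⁻¹ := by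
    rw [one_div, inv_pow]
    field_simp
  rw [heq] at h3
  refine h3.congr' ?_
  filter_upwards [eventually_gt_atTop 0, eventually_gt_atTop (-a)] with R hR hRa
  simp only [Function.comp]
  have hpos : (0 : ℝ) < (R + a) / m := div_pos (by linarith) hm0
  rw [volume_real_ball hR, div_pow _ R]
  field_simp

/-- Pulled back along `y ↦ t + m • y`, the ball lies between two centred balls of radius about `R /
m`, and both counts have the same limit. -/
theorem hasDensity_coset (hn : n ≠ 0) (t : EuclideanSpace ℝ (Fin n)) {m : ℕ} (hm : m ≠ 0) :
    HasDensity (coset Λ t m) (ZLattice.covolume Λ * (m : ℝ) ^ n)⁻¹ := by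
  have hm0 : (0 : ℝ) < m := by exact_mod_cast Nat.pos_of_ne_zero hm
  have hinj : Function.Injective fun y : EuclideanSpace ℝ (Fin n) => t + m • y := fun y z hyz => by
    have h := add_left_cancel hyz
    rw [← Nat.cast_smul_eq_nsmul ℝ, ← Nat.cast_smul_eq_nsmul ℝ] at h
    exact smul_right_injective _ hm0.ne' h
  have hnorm : ∀ y : EuclideanSpace ℝ (Fin n), ‖m • y‖ = m * ‖y‖ := fun y => by
    rw [← Nat.cast_smul_eq_nsmul ℝ, norm_smul, Real.norm_natCast]
  have himage : ∀ R : ℝ, coset Λ t m ∩ Metric.ball 0 R =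
      (fun y => t + m • y) '' ((Λ : Set (EuclideanSpace ℝ (Fin n))) ∩
        {y | t + m • y ∈ Metric.ball 0 R}) := fun R => by
    ext x
    constructor
    · rintro ⟨⟨y, hy, rfl⟩, hx⟩
      exact ⟨y, ⟨hy, hx⟩, rfl⟩
    · rintro ⟨y, ⟨hy, hx⟩, rfl⟩
      exact ⟨⟨y, hy, rfl⟩, hx⟩
  have hfin : ∀ ρ : ℝ, ((Λ : Set (EuclideanSpace ℝ (Fin n))) ∩ Metric.closedBall 0 ρ).Finite :=
    fun ρ => finite_inter_of_isBounded subset_rfl Metric.isBounded_closedBall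
  have hup : ∀ R : ℝ, (Λ : Set (EuclideanSpace ℝ (Fin n))) ∩ {y | t + m • y ∈ Metric.ball 0 R} ⊆
      (Λ : Set (EuclideanSpace ℝ (Fin n))) ∩ Metric.closedBall 0 ((R + ‖t‖) / m) := fun R y hy => by
    refine ⟨hy.1, ?_⟩
    have h1 : ‖t + m • y‖ < R := by simpa using hy.2
    rw [mem_closedBall_zero_iff, le_div_iff₀' hm0, ← hnorm]
    have := norm_sub_le (t + m • y) t
    rw [add_sub_cancel_left] at this
    linarith
  -- The extra `-1` turns the weak inequality of the closed ball into the strict one of the open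
  -- ball.
  have hlow : ∀ R : ℝ, (Λ : Set (EuclideanSpace ℝ (Fin n))) ∩
      Metric.closedBall 0 ((R + (-‖t‖ - 1)) / m) ⊆
      (Λ : Set (EuclideanSpace ℝ (Fin n))) ∩ {y | t + m • y ∈ Metric.ball 0 R} := fun R y hy => by
    refine ⟨hy.1, ?_⟩
    have h1 := hy.2
    rw [mem_closedBall_zero_iff, le_div_iff₀' hm0, ← hnorm] at h1
    have := norm_add_le t (m • y)
    rw [Set.mem_ofPred_eq, mem_ball_zero_iff]
    linarith
  refine tendsto_of_tendsto_of_tendsto_of_le_of_le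
    (tendsto_card_lattice_scaled Λ hn hm (-‖t‖ - 1)) (tendsto_card_lattice_scaled Λ hn hm ‖t‖)
    (fun R => ?_) fun R => ?_
  · beta_reduce
    rw [himage, Set.ncard_image_of_injective _ hinj]
    exact div_le_div_of_nonneg_right (Nat.cast_le.2 (Set.ncard_le_ncard (hlow R)
      ((hfin _).subset (hup R)))) measureReal_nonneg
  · beta_reduce
    rw [himage, Set.ncard_image_of_injective _ hinj]
    exact div_le_div_of_nonneg_right (Nat.cast_le.2 (Set.ncard_le_ncard (hup R) (hfin _)))
      measureReal_nonneg

variable {Λ} in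
theorem HasDensity.sdiff {A C : Set (EuclideanSpace ℝ (Fin n))} {α β : ℝ} (hC : HasDensity C β)
    (hA : HasDensity A α) (hAC : A ⊆ C) (hCΛ : C ⊆ Λ) : HasDensity (C \ A) (β - α) := by
  refine (Tendsto.sub hC hA).congr fun R => ?_
  have hfin : (C ∩ Metric.ball 0 R).Finite := finite_inter_of_isBounded hCΛ Metric.isBounded_ball
  have hset : C \ A ∩ Metric.ball 0 R = (C ∩ Metric.ball 0 R) \ (A ∩ Metric.ball 0 R) := by
    ext x
    simp only [Set.mem_inter_iff, Set.mem_sdiff]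
    tauto
  have hsub : A ∩ Metric.ball 0 R ⊆ C ∩ Metric.ball 0 R := Set.inter_subset_inter_left _ hAC
  rw [hset, Set.cast_ncard_sdiff hsub (hfin), sub_div]

end Density

/-! ### Chinese remainder theorem for cosets of sublattices -/

section Coset

variable {n : ℕ} {Λ : Submodule ℤ (EuclideanSpace ℝ (Fin n))}

/-- The intersection of cosets with coprime moduli is a coset. -/
theorem exists_coset_inter_eq {t c : EuclideanSpace ℝ (Fin n)} (ht : t ∈ Λ) (hc : c ∈ Λ) {m q : ℕ}
    (hmq : m.Coprime q) :
    ∃ t' ∈ Λ, coset Λ t m ∩ coset Λ c q = coset Λ t' (m * q) := by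
  obtain ⟨a, b, hab⟩ := Nat.isCoprime_iff_coprime.2 hmq
  have hab' : (a : ℝ) * m + b * q = 1 := by exact_mod_cast hab
  have hz : ∀ (i : ℤ) (v : EuclideanSpace ℝ (Fin n)), i • v = (i : ℝ) • v := fun i v =>
    (Int.cast_smul_eq_zsmul ℝ i v).symm
  have hN : ∀ (i : ℕ) (v : EuclideanSpace ℝ (Fin n)), i • v = (i : ℝ) • v := fun i v =>
    (Nat.cast_smul_eq_nsmul ℝ i v).symm
  have hbq : (b : ℝ) * q = 1 - a * m := by linarith
  -- By `a * m + b * q = 1` this point also equals `c + q • b • (t - c)`, so it lies in both cosets.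
  refine ⟨t + m • a • (c - t), Λ.add_mem ht (Λ.smul_of_tower_mem m (Λ.smul_mem a (Λ.sub_mem hc ht))),
    ?_⟩
  ext x
  constructor
  · rintro ⟨⟨y, hy, hxy⟩, ⟨w, hw, hxw⟩⟩
    -- With `t'` the new base point, `x - t'` is both `q • (w - b • (t - c))` and `m • (y - a • (c -
    -- t))`. Weighting these by `a * m` and `b * q` makes `m * q` a common factor.
    refine ⟨a • (w - b • (t - c)) + b • (y - a • (c - t)), Λ.add_mem
      (Λ.smul_mem a (Λ.sub_mem hw (Λ.smul_mem b (Λ.sub_mem ht hc))))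
      (Λ.smul_mem b (Λ.sub_mem hy (Λ.smul_mem a (Λ.sub_mem hc ht)))), ?_⟩
    have h1 : (q : ℝ) • w = x - c := by rw [hxw, hN]; abel
    have h2 : (m : ℝ) • y = x - t := by rw [hxy, hN]; abel
    have h3 : ((a : ℝ) * m) • ((q : ℝ) • w) + ((b : ℝ) * q) • ((m : ℝ) • y) =
        ((a : ℝ) * m) • (x - c) + ((b : ℝ) * q) • (x - t) := by rw [h1, h2]
    rw [hbq] at h3
    simp only [hN, hz, Nat.cast_mul]
    have h4 : x = (((a : ℝ) * m) • ((q : ℝ) • w) + (1 - (a : ℝ) * m) • ((m : ℝ) • y)) +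
        (((a : ℝ) * m) • c + (1 - (a : ℝ) * m) • t) := by rw [h3]; module
    have h5 : ((m : ℝ) * q) • ((a : ℝ) • (w - (b : ℝ) • (t - c)) + (b : ℝ) • (y - (a : ℝ) • (c - t))) =
        ((a : ℝ) * m) • ((q : ℝ) • w) + ((b : ℝ) * q) • ((m : ℝ) • y) := by module
    rw [h5, hbq]
    conv_lhs => rw [h4]
    module
  · rintro ⟨y, hy, rfl⟩
    refine ⟨⟨a • (c - t) + q • y, Λ.add_mem (Λ.smul_mem a (Λ.sub_mem hc ht))
      (Λ.smul_of_tower_mem q hy), ?_⟩, ⟨b • (t - c) + m • y, Λ.add_mem (Λ.smul_mem b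
      (Λ.sub_mem ht hc)) (Λ.smul_of_tower_mem m hy), ?_⟩⟩
    · simp only [hN, hz, Nat.cast_mul]
      module
    · simp only [hN, hz, Nat.cast_mul]
      have h5 : (q : ℝ) • ((b : ℝ) • (t - c) + (m : ℝ) • y) =
          ((b : ℝ) * q) • (t - c) + ((m : ℝ) * q) • y := by module
      rw [h5, hbq]
      module

end Coset

/-! ### Sieving lattice points by powers of primes -/

section Multiples

variable {n : ℕ} {Λ : Submodule ℤ (EuclideanSpace ℝ (Fin n))}

theorem mem_coset_iff {t x : EuclideanSpace ℝ (Fin n)} {m : ℕ} :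
    x ∈ coset Λ t m ↔ x - t ∈ multiples Λ m := by
  constructor
  · rintro ⟨y, hy, rfl⟩
    exact ⟨y, hy, by abel⟩
  · rintro ⟨y, hy, h⟩
    exact ⟨y, hy, by rw [h]; abel⟩

theorem coset_zero (m : ℕ) : coset Λ 0 m = multiples Λ m := by
  ext x
  rw [mem_coset_iff, sub_zero]

theorem multiples_one : multiples Λ 1 = Λ := by
  ext x
  exact ⟨fun ⟨y, hy, h⟩ => by rw [one_smul] at h; exact h ▸ hy, fun hx => ⟨x, hx, one_smul _ x⟩⟩

theorem multiples_subset_of_dvd {a b : ℕ} (h : a ∣ b) : multiples Λ b ⊆ multiples Λ a := by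
  obtain ⟨c, rfl⟩ := h
  rintro _ ⟨y, hy, rfl⟩
  exact ⟨c • y, Λ.smul_of_tower_mem c hy, by rw [smul_smul]⟩

theorem sub_mem_multiples {m : ℕ} {x y : EuclideanSpace ℝ (Fin n)} (hx : x ∈ multiples Λ m)
    (hy : y ∈ multiples Λ m) : x - y ∈ multiples Λ m := by
  obtain ⟨a, ha, rfl⟩ := hx
  obtain ⟨b, hb, rfl⟩ := hy
  exact ⟨a - b, Λ.sub_mem ha hb, smul_sub _ _ _⟩

theorem zero_mem_multiples (m : ℕ) : (0 : EuclideanSpace ℝ (Fin n)) ∈ multiples Λ m :=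
  ⟨0, Λ.zero_mem, smul_zero _⟩

/-- The intersection of the two sublattices is one coset modulo `a * b`; it contains `0` and `x`,
hence `x - 0` is a multiple. -/
theorem mem_multiples_mul {a b : ℕ} (hab : a.Coprime b) {x : EuclideanSpace ℝ (Fin n)}
    (ha : x ∈ multiples Λ a) (hb : x ∈ multiples Λ b) : x ∈ multiples Λ (a * b) := by
  obtain ⟨t', -, h⟩ := exists_coset_inter_eq Λ.zero_mem Λ.zero_mem (Λ := Λ) hab
  rw [coset_zero, coset_zero] at h
  have hx : x ∈ coset Λ t' (a * b) := h ▸ ⟨ha, hb⟩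
  have h0 : (0 : EuclideanSpace ℝ (Fin n)) ∈ coset Λ t' (a * b) :=
    h ▸ ⟨zero_mem_multiples a, zero_mem_multiples b⟩
  rw [mem_coset_iff] at hx h0
  have := sub_mem_multiples hx h0
  simpa using this

theorem mem_multiples_pow_iff {d k : ℕ} (hd : Squarefree d) {x : EuclideanSpace ℝ (Fin n)}
    (hx : x ∈ Λ) :
    x ∈ multiples Λ (d ^ k) ↔ ∀ p ∈ d.primeFactors, x ∈ multiples Λ (p ^ k) := by
  refine ⟨fun h p hp => multiples_subset_of_dvd (pow_dvd_pow_of_dvd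
    (Nat.dvd_of_mem_primeFactors hp) k) h, fun h => ?_⟩
  have key : ∀ T : Finset ℕ, T ⊆ d.primeFactors → x ∈ multiples Λ ((∏ p ∈ T, p) ^ k) := by
    intro T
    induction T using Finset.induction_on with
    | empty =>
      intro _
      rw [Finset.prod_empty, one_pow, multiples_one]
      exact hx
    | insert p T hp ih =>
      intro hT
      rw [Finset.prod_insert hp, mul_pow]
      refine mem_multiples_mul ?_ (h p (hT (Finset.mem_insert_self p T)))
        (ih ((Finset.subset_insert p T).trans hT))
      refine Nat.Coprime.pow k k (Nat.Coprime.prod_right fun q hq => ?_)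
      refine (Nat.coprime_primes (Nat.prime_of_mem_primeFactors (hT (Finset.mem_insert_self p T)))
        (Nat.prime_of_mem_primeFactors (hT (Finset.mem_insert_of_mem hq)))).2 ?_
      rintro rfl
      exact hp hq
  have := key _ subset_rfl
  rwa [Nat.prod_primeFactors_of_squarefree hd] at this

/-- A lattice point is `k`-free if and only if no `k`-th power of a prime divides it. -/
theorem mem_kFreePoints_iff {k : ℕ} {x : EuclideanSpace ℝ (Fin n)} :
    x ∈ kFreePoints Λ k ↔ x ∈ Λ ∧ ∀ p : ℕ, p.Prime → x ∉ multiples Λ (p ^ k) := by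
  refine and_congr_right fun hx => ?_
  constructor
  · intro h p hp hxp
    have : (p : ℕ∞) ≤ kContent Λ k x := le_iSup₂_of_le p hxp le_rfl
    rw [h] at this
    have : p ≤ 1 := by exact_mod_cast this
    exact absurd hp.two_le (by omega)
  · intro h
    refine le_antisymm (iSup₂_le fun c hc => ?_) (le_iSup₂_of_le 1 ⟨x, hx, by simp⟩ (by simp))
    by_contra hlt
    rw [not_le] at hlt
    have hc1 : c ≠ 1 := by rintro rfl; exact absurd hlt (by simp)
    obtain ⟨p, hp, hpc⟩ := Nat.exists_prime_and_dvd hc1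
    exact h p hp (multiples_subset_of_dvd (pow_dvd_pow_of_dvd hpc k) hc)

end Multiples

/-! ### Sieving by finitely many primes, and the product of local densities -/

section Sieve

variable {n : ℕ} (Λ : Submodule ℤ (EuclideanSpace ℝ (Fin n)))

/-- The points `x` of a coset such that neither `x` nor `x - z` is divisible by the `k`-th power
of an element of `S`. -/
def sifted (k : ℕ) (z : EuclideanSpace ℝ (Fin n)) (S : Finset ℕ) (t : EuclideanSpace ℝ (Fin n))
    (m : ℕ) : Set (EuclideanSpace ℝ (Fin n)) :=
  {x | x ∈ coset Λ t m ∧ ∀ p ∈ S, x ∉ coset Λ 0 (p ^ k) ∧ x ∉ coset Λ z (p ^ k)}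

open Classical in
/-- The local density at the prime `p` of the pairs of `k`-free points with difference `z`. -/
noncomputable def localDensity (k : ℕ) (z : EuclideanSpace ℝ (Fin n)) (p : ℕ) : ℝ :=
  1 - (if z ∈ multiples Λ (p ^ k) then 1 else 2) / (p : ℝ) ^ (n * k)

variable {Λ} in
theorem coset_subset {t : EuclideanSpace ℝ (Fin n)} (ht : t ∈ Λ) (m : ℕ) : coset Λ t m ⊆ Λ := by
  rintro _ ⟨y, hy, rfl⟩
  exact Λ.add_mem ht (Λ.smul_of_tower_mem m hy)

/-- Stated for all cosets to make the induction on `S` work: the part of a sifted coset in a class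
modulo `p ^ k` is a sifted coset of modulus `m * p ^ k`, with density smaller by `p ^ (n * k)`. The
classes of `0` and `z` coincide or are disjoint, so one or two such parts are removed. -/
theorem hasDensity_sifted [DiscreteTopology Λ] [IsZLattice ℝ Λ] (hn : n ≠ 0) (k : ℕ)
    {z : EuclideanSpace ℝ (Fin n)} (hz : z ∈ Λ) (S : Finset ℕ) (hS : ∀ p ∈ S, p.Prime) :
    ∀ t ∈ Λ, ∀ m : ℕ, m ≠ 0 → (∀ p ∈ S, m.Coprime p) →
      HasDensity (sifted Λ k z S t m)
        ((ZLattice.covolume Λ * (m : ℝ) ^ n)⁻¹ * ∏ p ∈ S, localDensity Λ k z p) := by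
  induction S using Finset.induction_on with
  | empty =>
    intro t ht m hm _
    have : sifted Λ k z ∅ t m = coset Λ t m := by
      ext x
      simp [sifted]
    rw [this, Finset.prod_empty, mul_one]
    exact hasDensity_coset Λ hn t hm
  | insert p S hpS ih =>
    intro t ht m hm hcop
    have hp : p.Prime := hS p (Finset.mem_insert_self p S)
    have ih' := ih fun q hq => hS q (Finset.mem_insert_of_mem hq)
    have hq0 : p ^ k ≠ 0 := pow_ne_zero k hp.ne_zero
    have hmq : m.Coprime (p ^ k) := (hcop p (Finset.mem_insert_self p S)).pow_right k
    have hinter : ∀ c ∈ Λ, ∃ t' ∈ Λ,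
        sifted Λ k z S t m ∩ coset Λ c (p ^ k) = sifted Λ k z S t' (m * p ^ k) := by
      intro c hc
      obtain ⟨t', ht', h⟩ := exists_coset_inter_eq ht hc hmq
      refine ⟨t', ht', ?_⟩
      ext x
      have := Set.ext_iff.1 h x
      simp only [sifted, Set.mem_inter_iff, Set.mem_ofPred_eq] at this ⊢
      tauto
    have hcop' : ∀ q ∈ S, (m * p ^ k).Coprime q := fun q hq => by
      refine Nat.Coprime.mul_left (hcop q (Finset.mem_insert_of_mem hq)) (Nat.Coprime.pow_left k ?_)
      refine (Nat.coprime_primes hp (hS q (Finset.mem_insert_of_mem hq))).2 ?_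
      rintro rfl
      exact hpS hq
    have hdens : ∀ c ∈ Λ, HasDensity (sifted Λ k z S t m ∩ coset Λ c (p ^ k))
        ((ZLattice.covolume Λ * (m : ℝ) ^ n)⁻¹ * (∏ q ∈ S, localDensity Λ k z q) /
          (p : ℝ) ^ (n * k)) := by
      intro c hc
      obtain ⟨t', ht', h⟩ := hinter c hc
      rw [h]
      have := ih' t' ht' (m * p ^ k) (mul_ne_zero hm hq0) hcop'
      convert this using 1
      push_cast
      rw [mul_pow, ← pow_mul, mul_comm k n, ← mul_assoc, mul_inv]
      ring
    have hbase := ih' t ht m hm fun q hq => hcop q (Finset.mem_insert_of_mem hq)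
    have hsubΛ : sifted Λ k z S t m ⊆ Λ := fun x hx => coset_subset ht m hx.1
    have h1 := hbase.sdiff (hdens 0 Λ.zero_mem) Set.inter_subset_left hsubΛ
    have hset : sifted Λ k z (insert p S) t m = (sifted Λ k z S t m \
        (sifted Λ k z S t m ∩ coset Λ 0 (p ^ k))) \ (sifted Λ k z S t m ∩ coset Λ z (p ^ k)) := by
      ext x
      simp only [sifted, Set.mem_inter_iff, Set.mem_ofPred_eq, Set.mem_sdiff,
        Finset.forall_mem_insert]
      tauto
    rw [hset, Finset.prod_insert hpS]
    by_cases hzp : z ∈ multiples Λ (p ^ k)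
    · have heq : coset Λ z (p ^ k) = coset Λ 0 (p ^ k) := by
        ext x
        rw [mem_coset_iff, mem_coset_iff, sub_zero]
        refine ⟨fun h => ?_, fun h => sub_mem_multiples h hzp⟩
        have h2 := sub_mem_multiples h (sub_mem_multiples (zero_mem_multiples (p ^ k)) hzp)
        simpa using h2
      rw [heq, sdiff_idem]
      convert h1 using 1
      rw [localDensity, if_pos hzp]
      ring
    · have hsub : sifted Λ k z S t m ∩ coset Λ z (p ^ k) ⊆ sifted Λ k z S t m \
          (sifted Λ k z S t m ∩ coset Λ 0 (p ^ k)) := by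
        rintro x ⟨hx, hxz⟩
        refine ⟨hx, fun hx0 => hzp ?_⟩
        rw [mem_coset_iff] at hxz
        have hx0' := hx0.2
        rw [mem_coset_iff, sub_zero] at hx0'
        have := sub_mem_multiples hx0' hxz
        simpa using this
      have h2 := h1.sdiff (hdens z hz) hsub (Set.sdiff_subset.trans hsubΛ)
      convert h2 using 1
      rw [localDensity, if_neg hzp]
      ring

/-- The local densities multiply up to the coefficient of the autocorrelation. -/
theorem hasProd_localDensity {k : ℕ} (hs : 2 ≤ n * k) {z : EuclideanSpace ℝ (Fin n)} (hz : z ∈ Λ) :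
    HasProd (fun p : PrimeNat => localDensity Λ k z p)
      (xi (n * k) * ∑' d : {d : ℕ // Squarefree d},
        (multiples Λ ((d : ℕ) ^ k)).indicator (fun _ => combWeight (n * k) d) z) := by
  classical
  set g : ℕ → ℝ := fun p => if z ∈ multiples Λ (p ^ k) then 1 / ((p : ℝ) ^ (n * k) - 2) else 0
    with hg
  have hgs : Summable fun p : PrimeNat => |g p| := by
    refine (summable_abs_combWeight_factor hs).of_nonneg_of_le (fun _ => abs_nonneg _) fun p => ?_
    simp only [hg]
    split_ifs
    · exact le_rfl
    · rw [abs_zero]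
      exact abs_nonneg _
  have h := (hasProd_xi hs).mul (hasProd_one_add hgs)
  have hterm : ∀ d : {d : ℕ // Squarefree d}, ∏ p ∈ (d : ℕ).primeFactors, g p =
      (multiples Λ ((d : ℕ) ^ k)).indicator (fun _ => combWeight (n * k) d) z := by
    intro d
    by_cases hzd : z ∈ multiples Λ ((d : ℕ) ^ k)
    · rw [Set.indicator_of_mem hzd, combWeight]
      refine Finset.prod_congr rfl fun p hp => ?_
      exact if_pos ((mem_multiples_pow_iff d.2 hz).1 hzd p hp)
    · rw [Set.indicator_of_notMem hzd]
      rw [mem_multiples_pow_iff d.2 hz] at hzd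
      push Not at hzd
      obtain ⟨p, hp, hzp⟩ := hzd
      exact Finset.prod_eq_zero hp (if_neg hzp)
  rw [tsum_congr hterm] at h
  -- It remains to compare factors: `(1 - 2 / P) * (1 + 1 / (P - 2)) = 1 - 1 / P` with `P = p ^ (n *
  -- k)`, and `1 - 2 / P` where `g` vanishes.
  refine HasProd.congr_fun h fun p => ?_
  have h4 := four_le_prime_pow p hs
  have h0 : ((p : ℕ) : ℝ) ^ (n * k) ≠ 0 := by linarith
  have h20 : ((p : ℕ) : ℝ) ^ (n * k) - 2 ≠ 0 := by linarith
  simp only [localDensity, hg]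
  split_ifs
  · field_simp
    ring
  · ring

end Sieve

/-! ### Tail estimate for large primes, and the density of `k`-free pairs -/

section Tail

variable {n : ℕ}

theorem diracComb_eq_encard (S : Set (EuclideanSpace ℝ (Fin n))) {A : Set (EuclideanSpace ℝ (Fin n))}
    (hA : MeasurableSet A) : diracComb S A = ((S ∩ A).encard : ℝ≥0∞) := by
  rw [diracComb_apply S hA, ← ENNReal.tsum_set_one, tsum_subtype S (A.indicator 1),
    tsum_subtype (S ∩ A) (fun _ => (1 : ℝ≥0∞))]
  refine tsum_congr fun x => ?_
  rw [Set.indicator_indicator]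
  rfl

variable (Λ : Submodule ℤ (EuclideanSpace ℝ (Fin n)))

/-- The number of nonzero points of `m Λ` in a ball centred at the origin. -/
theorem exists_encard_multiples_le [DiscreteTopology Λ] :
    ∃ C : ℝ, 0 ≤ C ∧ ∀ m : ℕ, m ≠ 0 → ∀ R : ℝ, 0 ≤ R →
      (((multiples Λ m \ {0}) ∩ Metric.ball 0 R).encard : ℝ≥0∞) ≤
        ENNReal.ofReal (C * R ^ n * (1 / (m : ℝ) ^ n)) := by
  obtain ⟨r, hr, h⟩ := exists_pos_le_dist_of_discrete Λ
  refine ⟨(3 / r) ^ n, by positivity, fun m hm R hR => ?_⟩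
  have hm0 : (0 : ℝ) < m := by exact_mod_cast Nat.pos_of_ne_zero hm
  have hsep : ∀ x ∈ multiples Λ m, ∀ y ∈ multiples Λ m, x ≠ y → r * m ≤ dist x y := by
    rintro _ ⟨x, hx, rfl⟩ _ ⟨y, hy, rfl⟩ hxy
    have := h x hx y hy fun he => hxy (by rw [he])
    rw [← Nat.cast_smul_eq_nsmul ℝ, ← Nat.cast_smul_eq_nsmul ℝ, dist_smul₀, Real.norm_natCast]
    nlinarith
  -- Without the origin no point is left when `R < r * m`; otherwise `1 ≤ R / (r * m)` absorbs the
  -- additive `1` of the packing bound. Hence the bound has no constant term, and can be summed over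
  -- primes.
  rcases lt_or_ge R (r * m) with hRm | hRm
  · have : (multiples Λ m \ {0}) ∩ Metric.ball 0 R = ∅ := by
      refine Set.eq_empty_of_forall_notMem fun x hx => ?_
      have h1 := hsep x hx.1.1 0 (zero_mem_multiples m) hx.1.2
      have h2 : dist x 0 < R := hx.2
      linarith
    rw [this]
    simp
  · rw [← diracComb_eq_encard _ measurableSet_ball]
    refine (diracComb_ball_le (mul_pos hr hm0) (fun x hx y hy => hsep x hx.1 y hy.1) 0 hR).trans ?_
    refine ENNReal.ofReal_le_ofReal ?_
    have h1 : (3 / r) ^ n * R ^ n * (1 / (m : ℝ) ^ n) = (3 * R / (r * m)) ^ n := by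
      rw [← mul_pow, ← one_div_pow, ← mul_pow]
      congr 1
      field_simp
    rw [h1]
    refine pow_le_pow_left₀ (by positivity) ?_ n
    have : 1 ≤ R / (r * m) := by rwa [one_le_div (mul_pos hr hm0)]
    calc 2 * R / (r * m) + 1 ≤ 2 * R / (r * m) + R / (r * m) := by gcongr
      _ = _ := by ring

/-- The points of a lattice other than `0` that are divisible by the `k`-th power of a prime outside
of `S`. -/
def divisibleOutside (k : ℕ) (S : Finset PrimeNat) : Set (EuclideanSpace ℝ (Fin n)) :=
  ⋃ p : {p : PrimeNat // p ∉ S}, multiples Λ ((p : ℕ) ^ k) \ {0}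

variable {Λ} in
theorem divisibleOutside_subset (k : ℕ) (S : Finset PrimeNat) : divisibleOutside Λ k S ⊆ Λ :=
  Set.iUnion_subset fun _ => Set.sdiff_subset.trans (multiples_subset _)

/-- Union bound over the primes outside `S`. The constant depends neither on `S` nor on `R`, so the
proportion of such points tends to `0` with the tail, uniformly in `R`. -/
theorem exists_ncard_divisibleOutside_le [DiscreteTopology Λ] [IsZLattice ℝ Λ] {k : ℕ} (hs : 2 ≤ n * k) :
    ∃ C : ℝ, 0 ≤ C ∧ ∀ S : Finset PrimeNat, ∀ R : ℝ, 0 ≤ R →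
      ((divisibleOutside Λ k S ∩ Metric.ball 0 R).ncard : ℝ) ≤
        C * R ^ n * ∑' p : {p : PrimeNat // p ∉ S}, 1 / ((p : ℕ) : ℝ) ^ (n * k) := by
  obtain ⟨C, hC, h⟩ := exists_encard_multiples_le Λ
  refine ⟨C, hC, fun S R hR => ?_⟩
  have hfin : ∀ A ⊆ (Λ : Set (EuclideanSpace ℝ (Fin n))), (A ∩ Metric.ball 0 R).Finite := fun A hA =>
    finite_inter_of_isBounded hA Metric.isBounded_ball
  have hsumm : Summable fun p : {p : PrimeNat // p ∉ S} => 1 / ((p : ℕ) : ℝ) ^ (n * k) :=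
    (summable_one_div_prime_pow hs).subtype {p | p ∉ S}
  have key : ((divisibleOutside Λ k S ∩ Metric.ball 0 R).encard : ℝ≥0∞) ≤
      ENNReal.ofReal (C * R ^ n * ∑' p : {p : PrimeNat // p ∉ S}, 1 / ((p : ℕ) : ℝ) ^ (n * k)) := by
    rw [← Measure.count_apply (hfin _ (divisibleOutside_subset k S)).measurableSet, divisibleOutside,
      Set.iUnion_inter, ← tsum_mul_left, ENNReal.ofReal_tsum_of_nonneg (fun p => by positivity)
        (hsumm.mul_left _)]
    refine (measure_iUnion_le _).trans (ENNReal.tsum_le_tsum fun p => ?_)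
    have hp0 : ((p : ℕ)) ^ k ≠ 0 := pow_ne_zero k p.1.2.ne_zero
    rw [Measure.count_apply (hfin _ (Set.sdiff_subset.trans (multiples_subset _))).measurableSet]
    refine (h _ hp0 R hR).trans (le_of_eq ?_)
    rw [Nat.cast_pow, ← pow_mul, mul_comm k n]
  rw [← (hfin _ (divisibleOutside_subset k S)).cast_ncard_eq] at key
  have h0 : 0 ≤ C * R ^ n * ∑' p : {p : PrimeNat // p ∉ S}, 1 / ((p : ℕ) : ℝ) ^ (n * k) :=
    mul_nonneg (by positivity) (tsum_nonneg fun p => by positivity)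
  have := ENNReal.toReal_mono ENNReal.ofReal_ne_top key
  rw [ENNReal.toReal_ofReal h0] at this
  simpa using this

/-- The points `x` such that `x` and `x - z` are both `k`-free. -/
def kFreePairs (k : ℕ) (z : EuclideanSpace ℝ (Fin n)) : Set (EuclideanSpace ℝ (Fin n)) :=
  {x | x ∈ kFreePoints Λ k ∧ x - z ∈ kFreePoints Λ k}

variable {Λ} in
theorem kFreePairs_subset_sifted (k : ℕ) (z : EuclideanSpace ℝ (Fin n)) (S : Finset PrimeNat) :
    kFreePairs Λ k z ⊆ sifted Λ k z (S.map (Function.Embedding.subtype _)) 0 1 := by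
  rintro x ⟨hx, hxz⟩
  rw [mem_kFreePoints_iff] at hx hxz
  refine ⟨by rw [coset_zero, multiples_one]; exact hx.1, fun p hp => ?_⟩
  obtain ⟨q, -, rfl⟩ := Finset.mem_map.1 hp
  rw [coset_zero, mem_coset_iff]
  exact ⟨hx.2 q q.2, hxz.2 q q.2⟩

variable {Λ} in
-- A sifted point fails to give a pair only if a prime outside `S` obstructs `x` or `x - z`. The
-- points `0` and `z` are listed apart because `divisibleOutside` omits the origin.
theorem sifted_sdiff_subset (k : ℕ) {z : EuclideanSpace ℝ (Fin n)} (hz : z ∈ Λ)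
    (S : Finset PrimeNat) (R : ℝ) :
    (sifted Λ k z (S.map (Function.Embedding.subtype _)) 0 1 \ kFreePairs Λ k z) ∩ Metric.ball 0 R ⊆
      (divisibleOutside Λ k S ∩ Metric.ball 0 (R + ‖z‖)) ∪
        ((fun x => x + z) '' (divisibleOutside Λ k S ∩ Metric.ball 0 (R + ‖z‖)) ∪ {0, z}) := by
  rintro x ⟨⟨hx, hnot⟩, hxR⟩
  have hxΛ : x ∈ Λ := by
    have := hx.1
    rwa [coset_zero, multiples_one] at this
  rw [mem_ball_zero_iff] at hxR
  by_cases hx0 : x = 0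
  · exact Or.inr (Or.inr (Or.inl hx0))
  by_cases hxz : x = z
  · exact Or.inr (Or.inr (Or.inr hxz))
  have hS : ∀ p : PrimeNat, p ∈ S → x ∉ multiples Λ ((p : ℕ) ^ k) ∧ x - z ∉ multiples Λ ((p : ℕ) ^ k) :=
    fun p hp => by
      have := hx.2 p (Finset.mem_map_of_mem _ hp)
      rwa [coset_zero, mem_coset_iff] at this
  have : (∃ p : ℕ, p.Prime ∧ x ∈ multiples Λ (p ^ k)) ∨
      ∃ p : ℕ, p.Prime ∧ x - z ∈ multiples Λ (p ^ k) := by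
    by_contra! hcon
    exact hnot ⟨mem_kFreePoints_iff.2 ⟨hxΛ, hcon.1⟩,
      mem_kFreePoints_iff.2 ⟨Λ.sub_mem hxΛ hz, hcon.2⟩⟩
  rcases this with ⟨p, hp, hxp⟩ | ⟨p, hp, hxp⟩
  · refine Or.inl ⟨Set.mem_iUnion.2 ⟨⟨⟨p, hp⟩, fun hpS => (hS _ hpS).1 hxp⟩, hxp, hx0⟩, ?_⟩
    rw [mem_ball_zero_iff]
    linarith [norm_nonneg z]
  · refine Or.inr (Or.inl ⟨x - z, ⟨Set.mem_iUnion.2 ⟨⟨⟨p, hp⟩, fun hpS => (hS _ hpS).2 hxp⟩, hxp,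
      fun h => hxz (sub_eq_zero.1 h)⟩, ?_⟩, sub_add_cancel x z⟩)
    rw [mem_ball_zero_iff]
    linarith [norm_sub_le x z]

/-- The density of the pairs of `k`-free points with difference `z`. -/
theorem hasDensity_kFreePairs [DiscreteTopology Λ] [IsZLattice ℝ Λ] (hn : n ≠ 0) {k : ℕ} (hs : 2 ≤ n * k)
    {z : EuclideanSpace ℝ (Fin n)} (hz : z ∈ Λ) :
    HasDensity (kFreePairs Λ k z) ((ZLattice.covolume Λ)⁻¹ * (xi (n * k) *
      ∑' d : {d : ℕ // Squarefree d},
        (multiples Λ ((d : ℕ) ^ k)).indicator (fun _ => combWeight (n * k) d) z)) := by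
  set δ := (ZLattice.covolume Λ)⁻¹ * (xi (n * k) * ∑' d : {d : ℕ // Squarefree d},
        (multiples Λ ((d : ℕ) ^ k)).indicator (fun _ => combWeight (n * k) d) z) with hδ
  set A := kFreePairs Λ k z
  set AS : Finset PrimeNat → Set (EuclideanSpace ℝ (Fin n)) := fun S =>
    sifted Λ k z (S.map (Function.Embedding.subtype _)) 0 1 with hAS
  set δS : Finset PrimeNat → ℝ := fun S =>
    (ZLattice.covolume Λ)⁻¹ * ∏ p ∈ S, localDensity Λ k z p with hδS
  have hASd : ∀ S, HasDensity (AS S) (δS S) := fun S => by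
    have := hasDensity_sifted Λ hn k hz (S.map (Function.Embedding.subtype _)) (fun p hp => by
      obtain ⟨q, -, rfl⟩ := Finset.mem_map.1 hp
      exact q.2) 0 Λ.zero_mem 1 one_ne_zero fun p _ => Nat.coprime_one_left p
    simpa [hδS, hAS] using this
  have hASΛ : ∀ S, AS S ⊆ Λ := fun S x hx => coset_subset Λ.zero_mem 1 hx.1
  have hlim : Tendsto δS atTop (𝓝 δ) := (hasProd_localDensity Λ hs hz).const_mul _
  obtain ⟨C, hC, hcount⟩ := exists_ncard_divisibleOutside_le Λ hs
  set V := volume.real (Metric.ball (0 : EuclideanSpace ℝ (Fin n)) 1) with hV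
  have hVpos : 0 < V := volume_real_ball_one_pos
  set ε : Finset PrimeNat → ℝ := fun S =>
    ∑' p : {p : PrimeNat // p ∉ S}, 1 / ((p : ℕ) : ℝ) ^ (n * k) with hε
  have hεlim : Tendsto ε atTop (𝓝 0) :=
    tendsto_tsum_compl_atTop_zero fun p : PrimeNat => 1 / ((p : ℕ) : ℝ) ^ (n * k)
  have hε0 : ∀ S, 0 ≤ ε S := fun S => tsum_nonneg fun p => by positivity
  set D : Set (EuclideanSpace ℝ (Fin n)) → ℝ → ℝ := fun T R =>
    ((T ∩ Metric.ball 0 R).ncard : ℝ) / volume.real (Metric.ball (0 : EuclideanSpace ℝ (Fin n)) R)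
  set K := 2 * C * 2 ^ n / V with hK
  -- For `‖z‖ ≤ R` the enlarged radius is at most `2 * R`, hence the `2 ^ n` in `K`; the other
  -- factor `2` counts obstructions at `x` and at `x - z`, and the last term the points `0` and `z`.
  have hdiff : ∀ S R, 1 ≤ R → ‖z‖ ≤ R → |D (AS S) R - D A R| ≤ K * ε S + 2 / (R ^ n * V) := by
    intro S R hR1 hRz
    have hR0 : 0 < R := by linarith
    have hsub : A ∩ Metric.ball 0 R ⊆ AS S ∩ Metric.ball 0 R :=
      Set.inter_subset_inter_left _ (kFreePairs_subset_sifted k z S)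
    have hfin : (AS S ∩ Metric.ball 0 R).Finite :=
      finite_inter_of_isBounded (hASΛ S) Metric.isBounded_ball
    have hfin' : (divisibleOutside Λ k S ∩ Metric.ball 0 (R + ‖z‖)).Finite :=
      finite_inter_of_isBounded (divisibleOutside_subset k S) Metric.isBounded_ball
    have h1 : (AS S ∩ Metric.ball 0 R) \ (A ∩ Metric.ball 0 R) = (AS S \ A) ∩ Metric.ball 0 R := by
      ext x
      simp only [Set.mem_inter_iff, Set.mem_sdiff]
      tauto
    have h2 : (((AS S \ A) ∩ Metric.ball 0 R).ncard : ℝ) ≤ 2 * (C * (2 * R) ^ n * ε S) + 2 := by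
      have h3 := Set.ncard_le_ncard (sifted_sdiff_subset k hz S R)
        (hfin'.union ((hfin'.image _).union (by simp)))
      have h4 := h3.trans (Set.ncard_union_le _ _)
      have h5 := Set.ncard_union_le ((fun x => x + z) '' (divisibleOutside Λ k S ∩
        Metric.ball 0 (R + ‖z‖))) {0, z}
      have h6 := Set.ncard_image_le (f := fun x => x + z) hfin'
      have h7 : ({0, z} : Set (EuclideanSpace ℝ (Fin n))).ncard ≤ 2 := (Set.ncard_insert_le 0 {z}).trans (by simp)
      have h8 : (((AS S \ A) ∩ Metric.ball 0 R).ncard) ≤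
          2 * (divisibleOutside Λ k S ∩ Metric.ball 0 (R + ‖z‖)).ncard + 2 := by
        change (AS S \ A ∩ Metric.ball 0 R).ncard ≤ _ at h4
        omega
      have h9 : (((AS S \ A) ∩ Metric.ball 0 R).ncard : ℝ) ≤
          2 * ((divisibleOutside Λ k S ∩ Metric.ball 0 (R + ‖z‖)).ncard : ℝ) + 2 := by
        exact_mod_cast h8
      refine h9.trans ?_
      have h10 := hcount S (R + ‖z‖) (by positivity)
      have h11 : C * (R + ‖z‖) ^ n * ε S ≤ C * (2 * R) ^ n * ε S := by
        have := hε0 S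
        gcongr
        linarith
      linarith [h10.trans h11]
    have h12 : D (AS S) R - D A R = (((AS S \ A) ∩ Metric.ball 0 R).ncard : ℝ) / (R ^ n * V) := by
      simp only [D]
      rw [← sub_div, ← Set.cast_ncard_sdiff hsub hfin, h1, volume_real_ball hR0]
    rw [h12, abs_of_nonneg (by positivity)]
    calc (((AS S \ A) ∩ Metric.ball 0 R).ncard : ℝ) / (R ^ n * V)
        ≤ (2 * (C * (2 * R) ^ n * ε S) + 2) / (R ^ n * V) := by gcongr
      _ = K * ε S + 2 / (R ^ n * V) := by
        rw [hK, mul_pow]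
        field_simp
  change Tendsto (D A) atTop (𝓝 δ)
  rw [Metric.tendsto_atTop']
  intro η hη
  have hKε : Tendsto (fun S => K * ε S) atTop (𝓝 0) := by simpa using hεlim.const_mul K
  -- `S` is fixed before `R`: this is possible because the tail term `K * ε S` does not involve `R`.
  obtain ⟨S, hS1, hS2⟩ := ((hKε.eventually (gt_mem_nhds (show 0 < η / 4 by positivity))).and
    (Metric.tendsto_nhds.1 hlim (η / 4) (by positivity))).exists
  have hR1 : Tendsto (fun R : ℝ => 2 / (R ^ n * V)) atTop (𝓝 0) :=
    ((tendsto_pow_atTop hn).atTop_mul_const hVpos).const_div_atTop 2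
  have hev := ((hR1.eventually (gt_mem_nhds (show 0 < η / 4 by positivity))).and
    ((Metric.tendsto_nhds.1 (hASd S) (η / 4) (by positivity)))).and
    ((eventually_ge_atTop 1).and (eventually_ge_atTop ‖z‖))
  obtain ⟨N, hN⟩ := eventually_atTop.1 hev
  refine ⟨N, fun R hR => ?_⟩
  obtain ⟨⟨h1, h2⟩, h3, h4⟩ := hN R hR.le
  have h5 := hdiff S R h3 h4
  have h2' : |D (AS S) R - δS S| < η / 4 := h2
  rw [Real.dist_eq] at hS2 ⊢
  rw [abs_le] at h5
  rw [abs_lt] at h2' hS2 ⊢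
  constructor <;> linarith

end Tail

/-! ### The autocorrelation -/

section Autocorrelation

variable {n : ℕ} (Λ : Submodule ℤ (EuclideanSpace ℝ (Fin n)))

variable {Λ} in
/-- The integral of a compactly supported function against a measure carried by a lattice. -/
theorem integral_eq_sum_of_lattice [DiscreteTopology Λ] {μ : Measure (EuclideanSpace ℝ (Fin n))}
    [IsLocallyFiniteMeasure μ] (hμ : μ (Λ : Set (EuclideanSpace ℝ (Fin n)))ᶜ = 0)
    (f : C_c(EuclideanSpace ℝ (Fin n), ℝ)) {F : Finset (EuclideanSpace ℝ (Fin n))}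
    (hF : ∀ x ∈ Λ, f x ≠ 0 → x ∈ F) : ∫ x, f x ∂μ = ∑ z ∈ F, μ.real {z} * f z := by
  have h1 : ∫ x, f x ∂μ = ∫ x in (F : Set (EuclideanSpace ℝ (Fin n))), f x ∂μ := by
    rw [← integral_indicator F.measurableSet]
    refine integral_congr_ae ?_
    have : ∀ᵐ x ∂μ, x ∈ (Λ : Set (EuclideanSpace ℝ (Fin n))) := hμ
    filter_upwards [this] with x hx
    by_cases hxF : x ∈ (F : Set (EuclideanSpace ℝ (Fin n)))
    · rw [Set.indicator_of_mem hxF]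
    · rw [Set.indicator_of_notMem hxF]
      by_contra hne
      exact hxF (hF x hx hne)
  rw [h1, setIntegral_finset F f.integrable.integrableOn]
  simp

theorem sum_dirac_compl {ι : Type*} {x : ι → EuclideanSpace ℝ (Fin n)}
    {S : Set (EuclideanSpace ℝ (Fin n))} (hS : MeasurableSet S) (hx : ∀ i, x i ∈ S) :
    (Measure.sum fun i => Measure.dirac (x i)) Sᶜ = 0 := by
  rw [Measure.sum_apply _ hS.compl, ENNReal.tsum_eq_zero]
  intro i
  rw [Measure.dirac_apply' _ hS.compl]
  simp [hx i]

variable {Λ} in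
theorem measurableSet_lattice [DiscreteTopology Λ] [IsZLattice ℝ Λ] :
    MeasurableSet (Λ : Set (EuclideanSpace ℝ (Fin n))) := by
  have : Countable Λ := inferInstance
  exact (Set.to_countable (Λ : Set (EuclideanSpace ℝ (Fin n)))).measurableSet

/-- The autocorrelation of the `k`-free points, as a sum of weighted Dirac combs. -/
noncomputable def autocorrelation (k : ℕ) : Measure (EuclideanSpace ℝ (Fin n)) :=
  Measure.sum fun d : {d : ℕ // Squarefree d} => autocorrelationTerm Λ k d

theorem autocorrelation_compl [DiscreteTopology Λ] [IsZLattice ℝ Λ] (k : ℕ) :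
    autocorrelation Λ k (Λ : Set (EuclideanSpace ℝ (Fin n)))ᶜ = 0 := by
  rw [autocorrelation, Measure.sum_apply _ measurableSet_lattice.compl, ENNReal.tsum_eq_zero]
  intro d
  rw [autocorrelationTerm, Measure.smul_apply, diracComb,
    sum_dirac_compl measurableSet_lattice fun x => multiples_subset _ x.2, smul_zero]

theorem diracComb_singleton (S : Set (EuclideanSpace ℝ (Fin n))) (z : EuclideanSpace ℝ (Fin n)) :
    diracComb S {z} = S.indicator 1 z := by
  rw [diracComb_eq_encard _ (measurableSet_singleton z)]
  by_cases hz : z ∈ S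
  · rw [Set.indicator_of_mem hz, Set.inter_eq_right.2 (Set.singleton_subset_iff.2 hz)]
    simp
  · rw [Set.indicator_of_notMem hz, Set.inter_singleton_eq_empty.2 hz]
    simp

theorem autocorrelation_real_singleton [DiscreteTopology Λ] [IsZLattice ℝ Λ] {k : ℕ}
    (hs : 2 ≤ n * k) (z : EuclideanSpace ℝ (Fin n)) :
    (autocorrelation Λ k).real {z} = (ZLattice.covolume Λ)⁻¹ * (xi (n * k) *
      ∑' d : {d : ℕ // Squarefree d},
        (multiples Λ ((d : ℕ) ^ k)).indicator (fun _ => combWeight (n * k) d) z) := by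
  have hcov := ZLattice.covolume_pos Λ volume
  have hxi := xi_pos hs
  have hterm : ∀ d : {d : ℕ // Squarefree d}, autocorrelationTerm Λ k d {z} = ENNReal.ofReal
      ((ZLattice.covolume Λ)⁻¹ * (xi (n * k) *
        (multiples Λ ((d : ℕ) ^ k)).indicator (fun _ => combWeight (n * k) d) z)) := by
    intro d
    rw [autocorrelationTerm, Measure.smul_apply, diracComb_singleton, smul_eq_mul]
    by_cases hz : z ∈ multiples Λ ((d : ℕ) ^ k)
    · rw [Set.indicator_of_mem hz, Set.indicator_of_mem hz, Pi.one_apply, mul_one]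
      congr 1
      ring
    · rw [Set.indicator_of_notMem hz, Set.indicator_of_notMem hz]
      simp
  rw [measureReal_def, autocorrelation, Measure.sum_apply _ (measurableSet_singleton z),
    ← tsum_mul_left, ← tsum_mul_left, tsum_congr hterm, ENNReal.tsum_toReal_eq
      fun _ => ENNReal.ofReal_ne_top]
  refine tsum_congr fun d => ENNReal.toReal_ofReal ?_
  have := combWeight_nonneg hs (d : ℕ)
  have : 0 ≤ (multiples Λ ((d : ℕ) ^ k)).indicator (fun _ => combWeight (n * k) d) z :=
    Set.indicator_nonneg (fun _ _ => this) z
  positivity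

variable {Λ} in
theorem kFreePoints_subset (k : ℕ) : kFreePoints Λ k ⊆ Λ := fun _ hx => hx.1

/-- The ordered pairs of points of `X` in a ball with difference `z`. -/
theorem finiteAutocorrelation_singleton (X : Set (EuclideanSpace ℝ (Fin n))) (R : ℝ)
    (z : EuclideanSpace ℝ (Fin n)) :
    finiteAutocorrelation X R {z} = (volume (Metric.ball (0 : EuclideanSpace ℝ (Fin n)) R))⁻¹ *
      (({x | x ∈ X ∩ Metric.ball 0 R ∧ x - z ∈ X ∩ Metric.ball 0 R}.encard : ℕ∞) : ℝ≥0∞) := by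
  rw [finiteAutocorrelation, Measure.smul_apply, smul_eq_mul,
    Measure.sum_apply _ (measurableSet_singleton z)]
  congr 1
  have h1 : ∀ p : ↥(X ∩ Metric.ball 0 R) × ↥(X ∩ Metric.ball 0 R),
      Measure.dirac ((p.1 : EuclideanSpace ℝ (Fin n)) - (p.2 : EuclideanSpace ℝ (Fin n))) {z} =
      {q : ↥(X ∩ Metric.ball 0 R) × ↥(X ∩ Metric.ball 0 R) | (q.1 : EuclideanSpace ℝ (Fin n)) -
        (q.2 : EuclideanSpace ℝ (Fin n)) = z}.indicator (fun _ => (1 : ℝ≥0∞)) p := fun p => by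
    rw [Measure.dirac_apply' _ (measurableSet_singleton z)]
    rfl
  rw [tsum_congr h1, ← tsum_subtype, ENNReal.tsum_set_one]
  congr 1
  have h2 : {x | x ∈ X ∩ Metric.ball 0 R ∧ x - z ∈ X ∩ Metric.ball 0 R} =
      (fun q : ↥(X ∩ Metric.ball 0 R) × ↥(X ∩ Metric.ball 0 R) => (q.1 : EuclideanSpace ℝ (Fin n))) ''
      {q | (q.1 : EuclideanSpace ℝ (Fin n)) - (q.2 : EuclideanSpace ℝ (Fin n)) = z} := by
    ext x
    constructor
    · rintro ⟨hx, hxz⟩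
      exact ⟨(⟨x, hx⟩, ⟨x - z, hxz⟩), sub_sub_cancel x z, rfl⟩
    · rintro ⟨⟨a, b⟩, hab, rfl⟩
      refine ⟨a.2, ?_⟩
      have : (a : EuclideanSpace ℝ (Fin n)) - z = b := by
        rw [← (show (a : EuclideanSpace ℝ (Fin n)) - b = z from hab), sub_sub_cancel]
      change (a : EuclideanSpace ℝ (Fin n)) - z ∈ _
      rw [this]
      exact b.2
  rw [h2, Set.InjOn.encard_image]
  rintro ⟨a, b⟩ hab ⟨a', b'⟩ hab' h
  have ha : (a : EuclideanSpace ℝ (Fin n)) = a' := h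
  have hab1 : (a : EuclideanSpace ℝ (Fin n)) - b = z := hab
  have hab2 : (a' : EuclideanSpace ℝ (Fin n)) - b' = z := hab'
  refine Prod.ext (Subtype.ext ha) (Subtype.ext ?_)
  rw [← sub_sub_cancel (a : EuclideanSpace ℝ (Fin n)) b, hab1, ha, ← hab2, sub_sub_cancel]

/-- The coefficients of the finite autocorrelations converge. -/
theorem tendsto_finiteAutocorrelation_real_singleton [DiscreteTopology Λ] [IsZLattice ℝ Λ]
    {k : ℕ} {z : EuclideanSpace ℝ (Fin n)} {δ : ℝ}
    (hδ : HasDensity (kFreePairs Λ k z) δ) :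
    Tendsto (fun R : ℝ => (finiteAutocorrelation (kFreePoints Λ k) R).real {z}) atTop (𝓝 δ) := by
  have hval : ∀ R : ℝ, (finiteAutocorrelation (kFreePoints Λ k) R).real {z} =
      (({x | x ∈ kFreePoints Λ k ∩ Metric.ball 0 R ∧
        x - z ∈ kFreePoints Λ k ∩ Metric.ball 0 R}.ncard : ℕ) : ℝ) /
      volume.real (Metric.ball (0 : EuclideanSpace ℝ (Fin n)) R) := fun R => by
    have hfin : {x | x ∈ kFreePoints Λ k ∩ Metric.ball 0 R ∧
        x - z ∈ kFreePoints Λ k ∩ Metric.ball 0 R}.Finite :=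
      (finite_inter_of_isBounded (kFreePoints_subset k) Metric.isBounded_ball).subset
        fun x hx => hx.1
    rw [measureReal_def, finiteAutocorrelation_singleton, ← hfin.cast_ncard_eq, ENNReal.toReal_mul,
      ENNReal.toReal_inv, ← measureReal_def, mul_comm, div_eq_mul_inv]
    simp
  simp only [hval]
  have hAΛ : kFreePairs Λ k z ⊆ Λ := fun x hx => hx.1.1
  have hfin : ∀ R : ℝ, (kFreePairs Λ k z ∩ Metric.ball 0 R).Finite := fun R =>
    finite_inter_of_isBounded hAΛ Metric.isBounded_ball
  have hshift : Tendsto (fun R : ℝ => R - ‖z‖) atTop atTop := tendsto_atTop_add_const_right _ _ tendsto_id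
  have hratio : Tendsto (fun R : ℝ => ((R - ‖z‖) / R) ^ n) atTop (𝓝 1) := by
    have : Tendsto (fun R : ℝ => (1 - ‖z‖ * R⁻¹) ^ n) atTop (𝓝 ((1 - ‖z‖ * 0) ^ n)) :=
      ((tendsto_inv_atTop_zero.const_mul _).const_sub 1).pow n
    rw [mul_zero, sub_zero, one_pow] at this
    refine this.congr' ?_
    filter_upwards [eventually_gt_atTop 0] with R hR
    field_simp
  -- The finite autocorrelation asks for both `x` and `x - z` in the ball, the density only for `x`.
  -- Pairs with `‖x‖ < R - ‖z‖` meet both demands, and the shrunken ball has asymptotically the same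
  -- volume.
  have hlow := (hδ.comp hshift).mul hratio
  rw [mul_one] at hlow
  refine tendsto_of_tendsto_of_tendsto_of_le_of_le' hlow hδ ?_ ?_
  · filter_upwards [eventually_gt_atTop 0, eventually_gt_atTop ‖z‖] with R hR hRz
    have hV := volume_real_ball_one_pos (n := n)
    have hRz' : 0 < R - ‖z‖ := sub_pos.2 hRz
    simp only [Function.comp]
    rw [volume_real_ball hR, volume_real_ball hRz', div_pow]
    have heq : ∀ c : ℝ, c / ((R - ‖z‖) ^ n * volume.real (Metric.ball (0 : EuclideanSpace ℝ (Fin n)) 1)) *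
        ((R - ‖z‖) ^ n / R ^ n) =
        c / (R ^ n * volume.real (Metric.ball (0 : EuclideanSpace ℝ (Fin n)) 1)) := fun c => by
      field_simp
    rw [heq]
    refine div_le_div_of_nonneg_right (Nat.cast_le.2 (Set.ncard_le_ncard (fun x hx => ?_)
      ((hfin R).subset fun x hx => ⟨⟨hx.1.1, hx.2.1⟩, hx.1.2⟩))) (by positivity)
    have hx2 : ‖x‖ < R - ‖z‖ := mem_ball_zero_iff.1 hx.2
    refine ⟨⟨hx.1.1, mem_ball_zero_iff.2 ?_⟩, ⟨hx.1.2, mem_ball_zero_iff.2 ?_⟩⟩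
    · linarith [norm_nonneg z]
    · linarith [norm_sub_le x z]
  · filter_upwards with R
    exact div_le_div_of_nonneg_right (Nat.cast_le.2 (Set.ncard_le_ncard
      (fun x hx => ⟨⟨hx.1.1, hx.2.1⟩, hx.1.2⟩) (hfin R))) measureReal_nonneg

theorem isLocallyFinite_finiteAutocorrelation [DiscreteTopology Λ] [IsZLattice ℝ Λ] (k : ℕ) {R : ℝ}
    (hR : 0 < R) : IsLocallyFiniteMeasure (finiteAutocorrelation (kFreePoints Λ k) R) := by
  have : Finite ↥(kFreePoints Λ k ∩ Metric.ball 0 R) :=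
    finite_inter_of_isBounded (kFreePoints_subset k) Metric.isBounded_ball
  have : Fintype ↥(kFreePoints Λ k ∩ Metric.ball 0 R) := Fintype.ofFinite _
  have hfin : IsFiniteMeasure (finiteAutocorrelation (kFreePoints Λ k) R) := by
    refine ⟨?_⟩
    rw [finiteAutocorrelation, Measure.smul_apply, Measure.sum_apply _ MeasurableSet.univ, smul_eq_mul]
    refine ENNReal.mul_lt_top (ENNReal.inv_lt_top.2 (Metric.measure_ball_pos _ _ hR)) ?_
    simp only [measure_univ, tsum_fintype, Finset.sum_const, Finset.card_univ]
    simp [ENNReal.mul_lt_top]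
  infer_instance

/-- Differences of `k`-free points lie in `Λ`, and the support of a test function meets `Λ` in
finitely many points. Vague convergence thus reduces to convergence of finitely many coefficients.
-/
theorem isNaturalAutocorrelation_autocorrelation [DiscreteTopology Λ] [IsZLattice ℝ Λ]
    (hn : n ≠ 0) {k : ℕ} (hs : 2 ≤ n * k) :
    IsNaturalAutocorrelation (kFreePoints Λ k) (autocorrelation Λ k) := by
  have hloc := (isUniformlySummable_autocorrelationTerm Λ hs).isBallBounded_sum.isLocallyFiniteMeasure
  change IsLocallyFiniteMeasure (autocorrelation Λ k) at hloc
  refine ⟨hloc, fun f => ?_⟩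
  have hfin : ((Λ : Set (EuclideanSpace ℝ (Fin n))) ∩ tsupport f).Finite :=
    finite_inter_of_isBounded subset_rfl f.hasCompactSupport.isBounded
  have hF : ∀ x ∈ Λ, f x ≠ 0 → x ∈ hfin.toFinset := fun x hx hfx =>
    hfin.mem_toFinset.2 ⟨hx, subset_tsupport _ hfx⟩
  rw [integral_eq_sum_of_lattice (autocorrelation_compl Λ k) f hF]
  have hlim : Tendsto (fun R : ℝ => ∑ z ∈ hfin.toFinset,
      (finiteAutocorrelation (kFreePoints Λ k) R).real {z} * f z) atTop
      (𝓝 (∑ z ∈ hfin.toFinset, (autocorrelation Λ k).real {z} * f z)) := by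
    refine tendsto_finsetSum _ fun z hz => Tendsto.mul_const _ ?_
    rw [autocorrelation_real_singleton Λ hs]
    exact tendsto_finiteAutocorrelation_real_singleton Λ
      (hasDensity_kFreePairs Λ hn hs (hfin.mem_toFinset.1 hz).1)
  refine hlim.congr' ?_
  filter_upwards [eventually_gt_atTop 0] with R hR
  have := isLocallyFinite_finiteAutocorrelation Λ k hR
  refine (integral_eq_sum_of_lattice ?_ f hF).symm
  rw [finiteAutocorrelation, Measure.smul_apply, sum_dirac_compl measurableSet_lattice
    fun p => Λ.sub_mem p.1.2.1.1 p.2.2.1.1, smul_zero]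

end Autocorrelation

/-! ### Uniqueness of the diffraction measure -/

section Uniqueness

variable {n : ℕ}

/-- Near `x` the integrable weight exceeds half its value at `x`, so Markov's inequality bounds the
mass there. -/
theorem isLocallyFiniteMeasure_of_hasTemperateGrowth {μ : Measure (EuclideanSpace ℝ (Fin n))}
    (hμ : μ.HasTemperateGrowth) : IsLocallyFiniteMeasure μ := by
  obtain ⟨N, hN⟩ := hμ.exists_integrable
  have hcont : Continuous fun x : EuclideanSpace ℝ (Fin n) => (1 + ‖x‖) ^ (-(N : ℝ)) :=
    Continuous.rpow_const (by fun_prop) fun x => Or.inl (by positivity)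
  refine ⟨fun x => ?_⟩
  have hpos : 0 < (1 + ‖x‖) ^ (-(N : ℝ)) := by positivity
  refine ⟨_, hcont.continuousAt.eventually (lt_mem_nhds (half_lt_self hpos)), ?_⟩
  refine lt_of_le_of_lt (measure_mono ?_) (hN.measure_ge_lt_top (half_pos hpos))
  intro y (hy : (1 + ‖x‖) ^ (-(N : ℝ)) / 2 < (1 + ‖y‖) ^ (-(N : ℝ)))
  exact hy.le

/-- A smooth bump equal to `1` on `K` and supported in the closed `r`-thickening is a Schwartz
function, hence has equal integrals. So `μ K` is at most the `ν`-mass of the thickening, which tends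
to `ν K` as `r → 0`. -/
theorem measure_le_of_toTemperedDistribution_eq {μ ν : Measure (EuclideanSpace ℝ (Fin n))}
    [hμ : μ.HasTemperateGrowth] [hν : ν.HasTemperateGrowth]
    (h : μ.toTemperedDistribution = ν.toTemperedDistribution)
    {K : Set (EuclideanSpace ℝ (Fin n))} (hK : IsCompact K) : μ K ≤ ν K := by
  have := isLocallyFiniteMeasure_of_hasTemperateGrowth hμ
  have := isLocallyFiniteMeasure_of_hasTemperateGrowth hν
  have hlim : Tendsto (fun r => ν (Metric.cthickening r K)) (𝓝[>] 0) (𝓝 (ν K)) :=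
    (tendsto_measure_cthickening_of_isCompact hK).mono_left nhdsWithin_le_nhds
  refine ge_of_tendsto hlim ?_
  filter_upwards [self_mem_nhdsWithin] with r hr
  have hr' : 0 < r := hr
  obtain ⟨f, hf, hf01, hfs, hf1⟩ := exists_contMDiff_support_eq_eq_one_iff
    (modelWithCornersSelf ℝ (EuclideanSpace ℝ (Fin n))) (n := ⊤)
    (Metric.isOpen_thickening (δ := r) (E := K)) hK.isClosed (Metric.self_subset_thickening hr' K)
  have hfd := contMDiff_iff_contDiff.1 hf
  have hfc : HasCompactSupport f :=
    HasCompactSupport.of_support_subset_isCompact (hK.cthickening (r := r))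
      (hfs.trans_subset (Metric.thickening_subset_cthickening r K))
  have hgc : HasCompactSupport (Complex.ofRealCLM ∘ f) := hfc.comp_left rfl
  have hint : ∀ ρ : Measure (EuclideanSpace ℝ (Fin n)), ∀ [ρ.HasTemperateGrowth],
      ρ.toTemperedDistribution (hgc.toSchwartzMap (Complex.ofRealCLM.contDiff.comp hfd)) =
      ((∫ x, f x ∂ρ : ℝ) : ℂ) := fun ρ _ => by
    rw [← integral_complex_ofReal]
    rfl
  have heq : ∫ x, f x ∂μ = ∫ x, f x ∂ν := by
    have h2 := hint μ
    rw [h, hint ν] at h2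
    exact_mod_cast h2.symm
  have hnn : ∀ x, 0 ≤ f x := fun x => (hf01 (Set.mem_range_self x)).1
  have hfi : ∀ ρ : Measure (EuclideanSpace ℝ (Fin n)), ∀ [IsLocallyFiniteMeasure ρ],
      Integrable f ρ := fun ρ _ => hfd.continuous.integrable_of_hasCompactSupport hfc
  have hμK : μ K ≤ ENNReal.ofReal (∫ x, f x ∂μ) := by
    rw [ofReal_integral_eq_lintegral_ofReal (hfi μ) (Eventually.of_forall hnn),
      ← lintegral_indicator_one hK.measurableSet]
    refine lintegral_mono fun x => ?_
    by_cases hx : x ∈ K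
    · rw [Set.indicator_of_mem hx, (hf1 x).1 hx]
      simp
    · rw [Set.indicator_of_notMem hx]
      exact zero_le
  have hνK : ENNReal.ofReal (∫ x, f x ∂ν) ≤ ν (Metric.cthickening r K) := by
    rw [ofReal_integral_eq_lintegral_ofReal (hfi ν) (Eventually.of_forall hnn),
      ← lintegral_indicator_one Metric.isClosed_cthickening.measurableSet]
    refine lintegral_mono fun x => ?_
    by_cases hx : x ∈ Metric.cthickening r K
    · rw [Set.indicator_of_mem hx]
      simpa using (hf01 (Set.mem_range_self x)).2
    · rw [Set.indicator_of_notMem hx, Function.notMem_support.1 fun hx' =>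
        hx (Metric.thickening_subset_cthickening r K (hfs ▸ hx'))]
      simp
  exact hμK.trans (heq ▸ hνK)

/-- A tempered distribution comes from at most one measure. -/
theorem eq_of_toTemperedDistribution_eq {μ ν : Measure (EuclideanSpace ℝ (Fin n))}
    [hμ : μ.HasTemperateGrowth] [hν : ν.HasTemperateGrowth]
    (h : μ.toTemperedDistribution = ν.toTemperedDistribution) : μ = ν := by
  have := isLocallyFiniteMeasure_of_hasTemperateGrowth hμ
  have := isLocallyFiniteMeasure_of_hasTemperateGrowth hν
  apply Measure.OuterRegular.ext_isOpen
  apply Measure.InnerRegularWRT.eq_of_innerRegularWRT_of_forall_eq Measure.Regular.innerRegular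
    Measure.Regular.innerRegular
  intro K hK
  exact le_antisymm (measure_le_of_toTemperedDistribution_eq h hK)
    (measure_le_of_toTemperedDistribution_eq h.symm hK)

theorem isNaturalAutocorrelation_unique {X : Set (EuclideanSpace ℝ (Fin n))}
    {γ γ' : Measure (EuclideanSpace ℝ (Fin n))} (h : IsNaturalAutocorrelation X γ)
    (h' : IsNaturalAutocorrelation X γ') : γ = γ' := by
  have := h.1
  have := h'.1
  exact Measure.ext_of_integral_eq_on_compactlySupported fun f =>
    tendsto_nhds_unique (h.2 f) (h'.2 f)

theorem isFourierTransformOf_unique {γ μ ν : Measure (EuclideanSpace ℝ (Fin n))}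
    (hμ : IsFourierTransformOf μ γ) (hν : IsFourierTransformOf ν γ) : μ = ν := by
  obtain ⟨_, _, h1⟩ := hμ
  obtain ⟨_, _, h2⟩ := hν
  exact eq_of_toTemperedDistribution_eq (h1.symm.trans h2)

end Uniqueness

/-! ### Positions and heights of the Bragg peaks -/

section Bragg

variable {n : ℕ} {Λ : Submodule ℤ (EuclideanSpace ℝ (Fin n))}

theorem sub_mem_dualLattice {x y : EuclideanSpace ℝ (Fin n)} (hx : x ∈ dualLattice Λ)
    (hy : y ∈ dualLattice Λ) : x - y ∈ dualLattice Λ := fun z hz => by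
  obtain ⟨a, ha⟩ := hx z hz
  obtain ⟨b, hb⟩ := hy z hz
  exact ⟨a - b, by rw [inner_sub_left, ha, hb, Int.cast_sub]⟩

theorem zsmul_mem_dualLattice {x : EuclideanSpace ℝ (Fin n)} (hx : x ∈ dualLattice Λ) (m : ℤ) :
    m • x ∈ dualLattice Λ := fun z hz => by
  obtain ⟨a, ha⟩ := hx z hz
  exact ⟨m * a, by rw [← Int.cast_smul_eq_zsmul ℝ, real_inner_smul_left, ha, Int.cast_mul]⟩

theorem nsmul_mem_dualLattice {x : EuclideanSpace ℝ (Fin n)} (hx : x ∈ dualLattice Λ) (m : ℕ) :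
    m • x ∈ dualLattice Λ := by
  rw [← natCast_zsmul]
  exact zsmul_mem_dualLattice hx m

theorem mem_rationalDual_iff {y : EuclideanSpace ℝ (Fin n)} :
    y ∈ rationalDual Λ ↔ ∃ a : ℕ, 0 < a ∧ a • y ∈ dualLattice Λ := by
  constructor
  · rintro ⟨r, z, hz, rfl⟩
    refine ⟨r.den, r.den_pos, ?_⟩
    have : r.den • (r : ℝ) • z = r.num • z := by
      rw [← Nat.cast_smul_eq_nsmul ℝ, ← Int.cast_smul_eq_zsmul ℝ, smul_smul]
      congr 1
      exact_mod_cast Rat.den_mul_eq_num r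
    rw [this]
    exact zsmul_mem_dualLattice hz _
  · rintro ⟨a, ha, h⟩
    refine ⟨(a : ℚ)⁻¹, a • y, h, ?_⟩
    have : (a : ℝ) ≠ 0 := by positivity
    rw [← Nat.cast_smul_eq_nsmul ℝ, smul_smul]
    push_cast
    rw [inv_mul_cancel₀ this, one_smul]

theorem denominator_spec {y : EuclideanSpace ℝ (Fin n)} (hy : y ∈ rationalDual Λ) :
    0 < denominator Λ y ∧ denominator Λ y • y ∈ dualLattice Λ :=
  Nat.sInf_mem (s := {a : ℕ | 0 < a ∧ a • y ∈ dualLattice Λ}) (mem_rationalDual_iff.1 hy)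

/-- Division with remainder: a nonzero remainder would contradict the minimality of the denominator.
-/
theorem nsmul_mem_dualLattice_iff {y : EuclideanSpace ℝ (Fin n)} (hy : y ∈ rationalDual Λ) {a : ℕ} :
    a • y ∈ dualLattice Λ ↔ denominator Λ y ∣ a := by
  obtain ⟨hq, hqy⟩ := denominator_spec hy
  constructor
  · intro h
    by_contra hdvd
    have hpos : 0 < a % denominator Λ y := Nat.pos_of_ne_zero fun h0 => hdvd (Nat.dvd_of_mod_eq_zero h0)
    have hmem : (a % denominator Λ y) • y ∈ dualLattice Λ := by
      have : (a % denominator Λ y) • y = a • y - (a / denominator Λ y) • denominator Λ y • y := by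
        rw [eq_sub_iff_add_eq, smul_smul, ← add_smul, mul_comm, Nat.mod_add_div]
      rw [this]
      exact sub_mem_dualLattice h (nsmul_mem_dualLattice hqy _)
    exact (Nat.sInf_le (s := {a : ℕ | 0 < a ∧ a • y ∈ dualLattice Λ}) ⟨hpos, hmem⟩).not_gt
      (Nat.mod_lt _ hq)
  · rintro ⟨c, hc⟩
    rw [hc, mul_comm, mul_smul]
    exact nsmul_mem_dualLattice hqy c

/-- The denominator divides `d ^ k`, in which every prime has exponent at most `k`. -/
theorem mem_braggPositions_of_squarefree {k d : ℕ} (hd : Squarefree d)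
    {y : EuclideanSpace ℝ (Fin n)} (hy : d ^ k • y ∈ dualLattice Λ) : y ∈ braggPositions Λ k := by
  have hyr : y ∈ rationalDual Λ :=
    mem_rationalDual_iff.2 ⟨d ^ k, pow_pos (Nat.pos_of_ne_zero hd.ne_zero) k, hy⟩
  refine ⟨hyr, fun p hp h => ?_⟩
  have h1 := h.trans ((nsmul_mem_dualLattice_iff hyr).1 hy)
  rw [hp.pow_dvd_iff_le_factorization (pow_ne_zero k hd.ne_zero), Nat.factorization_pow] at h1
  have h2 := hd.natFactorization_le_one p
  have h3 : k * d.factorization p ≤ k * 1 := Nat.mul_le_mul_left k h2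
  simp only [Finsupp.smul_apply, smul_eq_mul] at h1
  omega

/-- Prime exponents are at most `k` in `q`, and equal to `k` in `d ^ k` at each prime of `d`; only
the sets of primes matter. -/
theorem dvd_squarefree_pow_iff {k q d : ℕ} (hk : k ≠ 0) (hq0 : q ≠ 0) (hq : IsPowerFree (k + 1) q)
    (hd : Squarefree d) : q ∣ d ^ k ↔ q.primeFactors ⊆ d.primeFactors := by
  constructor
  · intro h
    have := Nat.primeFactors_mono h (pow_ne_zero k hd.ne_zero)
    rwa [Nat.primeFactors_pow _ hk] at this
  · intro h
    rw [← Nat.factorization_le_iff_dvd hq0 (pow_ne_zero k hd.ne_zero)]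
    intro p
    rw [Nat.factorization_pow, Finsupp.smul_apply, smul_eq_mul]
    by_cases hpq : p ∈ q.primeFactors
    · have hp := Nat.prime_of_mem_primeFactors hpq
      have h1 : 1 ≤ d.factorization p :=
        (hp.dvd_iff_one_le_factorization hd.ne_zero).1 (Nat.dvd_of_mem_primeFactors (h hpq))
      have h2 := hq p hp
      rw [hp.pow_dvd_iff_le_factorization hq0] at h2
      have h3 : k * 1 ≤ k * d.factorization p := Nat.mul_le_mul_left k h1
      omega
    · rw [← Nat.support_factorization, Finsupp.notMem_support_iff] at hpq
      rw [hpq]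
      exact Nat.zero_le _

theorem countable_dualLattice [DiscreteTopology Λ] [IsZLattice ℝ Λ] : (dualLattice Λ).Countable := by
  obtain ⟨B, hB, -⟩ := exists_basis_span_eq Λ
  subst hB
  obtain ⟨e, -⟩ := exists_equiv_dualLattice B
  exact Set.countable_coe_iff.1 e.symm.injective.countable

theorem countable_braggPositions [DiscreteTopology Λ] [IsZLattice ℝ Λ] (k : ℕ) :
    (braggPositions Λ k).Countable := by
  have : Countable (dualLattice Λ) := countable_dualLattice.to_subtype
  refine (Set.countable_range fun p : ℚ × dualLattice Λ =>
    (p.1 : ℝ) • (p.2 : EuclideanSpace ℝ (Fin n))).mono ?_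
  rintro _ ⟨⟨r, z, hz, rfl⟩, -⟩
  exact ⟨(r, ⟨z, hz⟩), rfl⟩

variable (Λ)

/-- The sum of the weighted Dirac combs that make up the diffraction of the `k`-free points. -/
noncomputable def diffraction (k : ℕ) : Measure (EuclideanSpace ℝ (Fin n)) :=
  Measure.sum fun d : {d : ℕ // Squarefree d} => diffractionTerm Λ k d

theorem diffraction_compl [DiscreteTopology Λ] [IsZLattice ℝ Λ] (k : ℕ) :
    diffraction Λ k (braggPositions Λ k)ᶜ = 0 := by
  have hm := (countable_braggPositions (Λ := Λ) k).measurableSet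
  rw [diffraction, Measure.sum_apply _ hm.compl, ENNReal.tsum_eq_zero]
  intro d
  rw [diffractionTerm, Measure.smul_apply, diracComb,
    sum_dirac_compl hm fun x => mem_braggPositions_of_squarefree d.2 x.2, smul_zero]

/-- The comb indexed by `d` charges `y` iff the denominator divides `d ^ k`, i.e. iff its primes all
divide `d`; `xi_mul_tsum_coeff` sums exactly these coefficients. -/
theorem diffraction_real_singleton [DiscreteTopology Λ] [IsZLattice ℝ Λ] {k : ℕ} (hk : k ≠ 0)
    (hs : 2 ≤ n * k) {y : EuclideanSpace ℝ (Fin n)} (hy : y ∈ braggPositions Λ k) :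
    (((diffraction Λ k).real {y} : ℝ) : ℂ) =
      1 / riemannZeta ((n * k : ℕ) : ℂ) ^ 2 *
        (∏ p ∈ (denominator Λ y).primeFactors, 1 / ((p : ℂ) ^ (n * k) - 1) ^ 2) /
        (ZLattice.covolume Λ : ℂ) ^ 2 := by
  have hxi := xi_pos hs
  have hterm : ∀ d : {d : ℕ // Squarefree d}, diffractionTerm Λ k d {y} = ENNReal.ofReal
      ((xi (n * k) * if (denominator Λ y).primeFactors ⊆ (d : ℕ).primeFactors then
        ∏ p ∈ (d : ℕ).primeFactors, 1 / ((p : ℝ) ^ (2 * (n * k)) - 2 * (p : ℝ) ^ (n * k)) else 0) /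
        ZLattice.covolume Λ ^ 2) := by
    intro d
    have hiff : y ∈ {y | (d : ℕ) ^ k • y ∈ dualLattice Λ} ↔
        (denominator Λ y).primeFactors ⊆ (d : ℕ).primeFactors :=
      (nsmul_mem_dualLattice_iff hy.1).trans
        (dvd_squarefree_pow_iff hk (denominator_spec hy.1).1.ne' hy.2 d.2)
    rw [diffractionTerm, Measure.smul_apply, diracComb_singleton, smul_eq_mul, mul_assoc 2 n k]
    by_cases h : (denominator Λ y).primeFactors ⊆ (d : ℕ).primeFactors
    · rw [Set.indicator_of_mem (hiff.2 h), if_pos h, Pi.one_apply, mul_one]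
    · rw [Set.indicator_of_notMem (mt hiff.1 h), if_neg h]
      simp
  have hreal : (diffraction Λ k).real {y} = (xi (n * k) * ∑' d : {d : ℕ // Squarefree d},
      if (denominator Λ y).primeFactors ⊆ (d : ℕ).primeFactors then
        ∏ p ∈ (d : ℕ).primeFactors, 1 / ((p : ℝ) ^ (2 * (n * k)) - 2 * (p : ℝ) ^ (n * k)) else 0) /
        ZLattice.covolume Λ ^ 2 := by
    rw [measureReal_def, diffraction, Measure.sum_apply _ (measurableSet_singleton y),
      ← tsum_mul_left, ← tsum_div_const, tsum_congr hterm,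
      ENNReal.tsum_toReal_eq fun _ => ENNReal.ofReal_ne_top]
    refine tsum_congr fun d => ENNReal.toReal_ofReal ?_
    have h0 := series_coeff_nonneg hs (d : ℕ)
    rw [mul_assoc 2 n k] at h0
    split_ifs <;> positivity
  rw [hreal, Complex.ofReal_div, xi_mul_tsum_coeff hs _ fun p hp => Nat.prime_of_mem_primeFactors hp,
    Complex.ofReal_pow]

theorem isDiffractionMeasure_kFreePoints_iff [DiscreteTopology Λ] [IsZLattice ℝ Λ] (hn : n ≠ 0)
    {k : ℕ} (hs : 2 ≤ n * k) (ν : Measure (EuclideanSpace ℝ (Fin n))) :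
    IsDiffractionMeasure (kFreePoints Λ k) ν ↔ ν = diffraction Λ k := by
  have h1 := isNaturalAutocorrelation_autocorrelation Λ hn hs
  have h2 : IsFourierTransformOf (diffraction Λ k) (autocorrelation Λ k) := isFourierTransformOf_sum Λ hs
  constructor
  · rintro ⟨γ, hγ, hν⟩
    rw [isNaturalAutocorrelation_unique hγ h1] at hν
    exact isFourierTransformOf_unique hν h2
  · rintro rfl
    exact ⟨_, h1, h2⟩

end Bragg

end KFreeDiffraction

theorem mainTheorem5 (n k : ℕ) (hn : 1 ≤ n) (hk : 1 ≤ k) (hnk : n = 1 → 2 ≤ k)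
    (Λ : Submodule ℤ (EuclideanSpace ℝ (Fin n))) [DiscreteTopology Λ] [IsZLattice ℝ Λ] :
    ∃ μ : Measure (EuclideanSpace ℝ (Fin n)),
      (∀ ν : Measure (EuclideanSpace ℝ (Fin n)),
        KFreeDiffraction.IsDiffractionMeasure (KFreeDiffraction.kFreePoints Λ k) ν ↔ ν = μ) ∧
      KFreeDiffraction.IsPurePoint μ ∧
      KFreeDiffraction.IsTranslationBounded μ ∧
      μ (KFreeDiffraction.braggPositions Λ k)ᶜ = 0 ∧
      (∀ y ∈ KFreeDiffraction.braggPositions Λ k,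
        ((μ.real {y} : ℝ) : ℂ) =
          1 / riemannZeta ((n * k : ℕ) : ℂ) ^ 2 *
            (∏ p ∈ (KFreeDiffraction.denominator Λ y).primeFactors,
              1 / ((p : ℂ) ^ (n * k) - 1) ^ 2) /
            (ZLattice.covolume Λ : ℂ) ^ 2) ∧
      KFreeDiffraction.IsWeakStarSum
        (fun d : {d : ℕ // Squarefree d} => KFreeDiffraction.diffractionTerm Λ k d) μ ∧
      KFreeDiffraction.IsLocalNormSum
        (fun d : {d : ℕ // Squarefree d} => KFreeDiffraction.diffractionTerm Λ k d) μ := by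
  -- The only use of `k ≥ 2` for `n = 1`.
  have hs : 2 ≤ n * k := by
    rcases hn.eq_or_lt with rfl | h
    · rw [one_mul]
      exact hnk rfl
    · exact h.trans_le (Nat.le_mul_of_pos_right n hk)
  have hsum := KFreeDiffraction.isUniformlySummable_diffractionTerm Λ hs
  exact ⟨KFreeDiffraction.diffraction Λ k,
    KFreeDiffraction.isDiffractionMeasure_kFreePoints_iff Λ (Nat.one_le_iff_ne_zero.1 hn) hs,
    ⟨_, KFreeDiffraction.countable_braggPositions k, KFreeDiffraction.diffraction_compl Λ k⟩,
    hsum.isBallBounded_sum.isTranslationBounded,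
    KFreeDiffraction.diffraction_compl Λ k,
    fun _ hy => KFreeDiffraction.diffraction_real_singleton Λ (Nat.one_le_iff_ne_zero.1 hk) hs hy,
    hsum.isWeakStarSum, hsum.isLocalNormSum⟩
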